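/- Let $n\ge 0$, let $S_{n+1}$ be the symmetric group on $\{1,\dots,n+1\}$ with adjacent transpositions $s_1,\dots,s_n$ and element $\omega_0$ of maximal inversion number, and let $x=(x_1,\dots,x_{n+1})$, $y=(y_1,\dots,y_{n+1})$. **Polynomials.** For $1\le i\le n$ and a polynomial $f$ over $\mathbb Z$ in the variables $x$ (or $x,y$), put $\delta_i(f)=\frac{f-s_if}{x_i-x_{i+1}}$, where $s_i$ interchanges $x_i$ and $x_{i+1}$ (and fixes every $y_j$), and $\pi_i(f)=\delta_i(f)+\delta_i(x_{i+1}f)$. For $w\in S_{n+1}$ put $\pi_w=\pi_{i_1}\cdots\pi_{i_\ell}$, where $w=s_{i_1}\cdots s_{i_\ell}$ is a reduced word, i.e. $\ell$ is the inversion number of $w$; the operator does not depend on the choice of the reduced word. For $\omega\in S_{n+1}$ define the Grothendieck and double Grothendieck polynomials $$\mathfrak G_\omega(x)=\pi_{\omega^{-1}\omega_0}\bigl(x_1^{n}x_2^{n-1}\cdots x_n^1x_{n+1}^0\bigr),\qquad \mathfrak G_\omega(x,y)=\pi_{\omega^{-1}\omega_0}\Bigl(\prod_{i,j\ge1,\ i+j\le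 n+1}(x_i+y_j+x_iy_j)\Bigr).$$ **Hecke words.** Write a permutation as the arrangement $(w(1),\dots,w(n+1))$. The operator $\bar s_i$ interchanges the entries $i$ and $i+1$ of an arrangement if $i$ lies to the left of $i+1$, and does nothing otherwise. A word $i_1\cdots i_k$ in the letters $1,\dots,n$ is a Hecke word for $\omega$ if applying $\bar s_{i_k},\dots,\bar s_{i_1}$ in this order (right to left) to $(1,2,\dots,n+1)$ gives $\omega$. * A *bounded circled Hecke factorization* of $\omega$ is a sequence of $n+1$ (possibly empty) words in the letters ①, $1$, ②, $2$, …, ⓝ, $n$, each strictly decreasing for the order ① $<1<$ ② $<2<\cdots<$ ⓝ $<n$, such that all letters of the $i$-th word have value at least $i$, and such that the concatenation of the words from left to right is, after erasing the circles, a Hecke word for $\omega$. The $i$-th entry of its $x$-weight is the number of uncircled letters in the $i$-th word. The $i$-th entry of its $y$-weight is the number of circled letters that have some value $j$ and occur in some word $k$ with $j-k+1=i$. Let $\mathfrak F^{\circ}_\omega$ be the set of these factorizations. * A *bounded double Hecke factorization* of $\omega$ is a sequence of words $(g_{n+1})\cdots(g_2)(g_1)\,|\,(h_1)(h_2)\cdots(h_{n+1})$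 in the letters $1,\dots,n$, with each $g_i$ strictly increasing, each $h_i$ strictly decreasing, all letters of $g_i$ and of $h_i$ at least $i$, and with concatenation $g_{n+1}\cdots g_1h_1\cdots h_{n+1}$ a Hecke word for $\omega$. The $i$-th entry of its $x$-weight is the length of $h_i$, and the $i$-th entry of its $y$-weight is the length of $g_i$. Let $\mathfrak F^{\square}_\omega$ be the set of these factorizations. * $X_\omega$ is the set of pairs $(u,v)\in S_{n+1}\times S_{n+1}$ such that the concatenation of a Hecke word for $u$ and a Hecke word for $v$ is a Hecke word for $\omega$. For a factorization $\mathfrak f$ let $(x,y)^{wt(\mathfrak f)}=\prod_i x_i^{a_i}\prod_i y_i^{b_i}$, where $a$ is its $x$-weight and $b$ its $y$-weight. **Theorem.** For every $\omega\in S_{n+1}$, $$\mathfrak G_\omega(x,y)=\sum_{\mathfrak f\in\mathfrak F^{\circ}_\omega}(x,y)^{wt(\mathfrak f)},\qquad \mathfrak G_\omega(x,y)=\sum_{\mathfrak f\in\mathfrak F^{\square}_\omega}(x,y)^{wt(\mathfrak f)},\qquad \mathfrak G_\omega(x,y)=\sum_{(u,v)\in X_\omega}\mathfrak G_{u^{-1}}(y)\,\mathfrak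 G_v(x).$$ -/

import Mathlib

open Equiv

/-! ## Permutations, reduced words, Hecke words

The letters `1, …, n` are the elements of `Fin n`, and `S_{n+1}` is `Equiv.Perm (Fin (n + 1))`;
everything is shifted so that indices start at `0`. A permutation `w` is the arrangement
`(w 0, w 1, …, w n)`. -/

/-- The adjacent transposition `s_i`. -/
def adjSwap {n : ℕ} (i : Fin n) : Perm (Fin (n + 1)) := swap i.castSucc i.succ

/-- The product `s_{i_1} ⋯ s_{i_k}` of a word in the adjacent transpositions. -/
def wordProd {n : ℕ} (a : List (Fin n)) : Perm (Fin (n + 1)) := (a.map adjSwap).prod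

/-- The inversion number of a permutation. -/
def invCount {m : ℕ} (w : Perm (Fin m)) : ℕ :=
  (Finset.univ.filter fun p : Fin m × Fin m => p.1 < p.2 ∧ w p.2 < w p.1).card

/-- `a` is a reduced word of `w`: the letters multiply to `w`, and there are as many of them as
`w` has inversions. -/
def IsReducedWord {n : ℕ} (a : List (Fin n)) (w : Perm (Fin (n + 1))) : Prop :=
  wordProd a = w ∧ a.length = invCount w

/-- The operator `s̄_i`: interchange the entries `i` and `i + 1` of the arrangement `w` if `i` lies
to the left of `i + 1`, and do nothing otherwise. -/
def heckeAct {n : ℕ} (i : Fin n) (w : Perm (Fin (n + 1))) : Perm (Fin (n + 1)) :=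
  if w⁻¹ i.castSucc < w⁻¹ i.succ then adjSwap i * w else w

/-- `a` is a Hecke word for `w`: applying its operators, from right to left, to the arrangement
`(0, 1, …, n)` gives `w`. -/
def IsHeckeWord {n : ℕ} (a : List (Fin n)) (w : Perm (Fin (n + 1))) : Prop :=
  a.foldr heckeAct 1 = w

/-- The permutation with the maximal inversion number. -/
def longestPerm (n : ℕ) : Perm (Fin (n + 1)) := Fin.revPerm

/-- The set `X_w` of pairs `(u, v)` for which the concatenation of a Hecke word for `u` and a
Hecke word for `v` is a Hecke word for `w`. -/
def heckePairs {n : ℕ} (w : Perm (Fin (n + 1))) :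
    Set (Perm (Fin (n + 1)) × Perm (Fin (n + 1))) :=
  {p | ∃ a b : List (Fin n), IsHeckeWord a p.1 ∧ IsHeckeWord b p.2 ∧ IsHeckeWord (a ++ b) w}

theorem adjSwap_lt {n : ℕ} (i : Fin n) {p q : Fin (n + 1)} (h : p < q)
    (hne : ¬(p = i.castSucc ∧ q = i.succ)) : adjSwap i p < adjSwap i q := by
  unfold adjSwap
  rw [swap_apply_def, swap_apply_def]
  split_ifs <;> simp only [Fin.lt_def, Fin.ext_iff, Fin.val_castSucc, Fin.val_succ] at * <;> omega

theorem invCount_mul_adjSwap {n : ℕ} (w : Perm (Fin (n + 1))) (i : Fin n)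
    (hi : w i.succ < w i.castSucc) : invCount w = invCount (w * adjSwap i) + 1 := by
  have hs : ∀ p, adjSwap i (adjSwap i p) = p := fun p => by simp [adjSwap]
  have h0 : adjSwap i i.castSucc = i.succ := by simp [adjSwap]
  have h1 : adjSwap i i.succ = i.castSucc := by simp [adjSwap]
  have hmem : (i.castSucc, i.succ) ∈
      Finset.univ.filter fun p : Fin (n + 1) × Fin (n + 1) => p.1 < p.2 ∧ w p.2 < w p.1 := by
    simpa [Fin.castSucc_lt_succ] using hi
  unfold invCount
  rw [← Finset.card_erase_add_one hmem]
  congr 1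
  refine Finset.card_nbij' (fun p => (adjSwap i p.1, adjSwap i p.2))
    (fun p => (adjSwap i p.1, adjSwap i p.2)) ?_ ?_ ?_ ?_
  · rintro ⟨p, q⟩ h
    obtain ⟨hne, h⟩ := Finset.mem_erase.mp (Finset.mem_coe.mp h)
    obtain ⟨h2, h3⟩ := (Finset.mem_filter.mp h).2
    refine Finset.mem_coe.mpr (Finset.mem_filter.mpr ⟨Finset.mem_univ _, ?_, ?_⟩)
    · exact adjSwap_lt i h2 fun hpq => hne (Prod.ext hpq.1 hpq.2)
    · simpa only [Perm.coe_mul, Function.comp_apply, hs] using h3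
  · rintro ⟨p, q⟩ h
    obtain ⟨h2, h3⟩ := (Finset.mem_filter.mp (Finset.mem_coe.mp h)).2
    simp only [Perm.coe_mul, Function.comp_apply] at h2 h3
    have hne : ¬(p = i.castSucc ∧ q = i.succ) := by
      rintro ⟨rfl, rfl⟩
      rw [h0, h1] at h3
      exact lt_asymm hi h3
    refine Finset.mem_coe.mpr (Finset.mem_erase.mpr
      ⟨?_, Finset.mem_filter.mpr ⟨Finset.mem_univ _, adjSwap_lt i h2 hne, h3⟩⟩)
    intro hpq
    obtain ⟨h4, h5⟩ := Prod.mk.inj hpq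
    have hp : p = i.succ := by rw [← hs p, h4, h0]
    have hq : q = i.castSucc := by rw [← hs q, h5, h1]
    rw [hp, hq] at h2
    exact lt_asymm h2 Fin.castSucc_lt_succ
  · rintro ⟨p, q⟩ _
    simp [hs]
  · rintro ⟨p, q⟩ _
    simp [hs]

theorem exists_isReducedWord {n : ℕ} (w : Perm (Fin (n + 1))) :
    ∃ a : List (Fin n), IsReducedWord a w := by
  induction hk : invCount w generalizing w with
  | zero =>
    refine ⟨[], ?_, by simp [hk]⟩
    have hmono : StrictMono w := by
      rw [Fin.strictMono_iff_lt_succ]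
      intro i
      by_contra hlt
      have hi : w i.succ < w i.castSucc := lt_of_le_of_ne (not_lt.mp hlt) fun h =>
        (Fin.castSucc_lt_succ (i := i)).ne' (w.injective h)
      have := invCount_mul_adjSwap w i hi
      omega
    have : (w : Fin (n + 1) → Fin (n + 1)) = id := by
      have hid := Subsingleton.elim (hmono.orderIsoOfSurjective w w.surjective)
        (OrderIso.refl (Fin (n + 1)))
      funext x
      exact DFunLike.congr_fun hid x
    ext x
    simp [wordProd, this]
  | succ k ih =>
    have : ∃ i : Fin n, w i.succ < w i.castSucc := by
      by_contra! hle
      have hmono : Monotone w := Fin.monotone_iff_le_succ.mpr hle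
      have h0 : invCount w = 0 := by
        unfold invCount
        rw [Finset.card_eq_zero, Finset.filter_eq_empty_iff]
        rintro ⟨p, q⟩ _ ⟨h1, h2⟩
        exact absurd (hmono h1.le) (not_le.mpr h2)
      omega
    obtain ⟨i, hi⟩ := this
    have h := invCount_mul_adjSwap w i hi
    obtain ⟨a, ha, hl⟩ := ih (w * adjSwap i) (by omega)
    refine ⟨a ++ [i], ?_, by simp [hl]; omega⟩
    unfold wordProd at ha ⊢
    rw [List.map_append, List.prod_append, ha]
    simp [adjSwap, mul_assoc]

/-! ## Isobaric divided differences and Grothendieck polynomials -/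

section Polynomials

open MvPolynomial

theorem X_sub_X_dvd_sub_rename_swap {σ : Type} [DecidableEq σ] (a b : σ) (f : MvPolynomial σ ℤ) :
    (X a - X b : MvPolynomial σ ℤ) ∣ f - rename (swap a b) f := by
  rw [← Ideal.mem_span_singleton, ← Ideal.Quotient.mk_eq_mk_iff_sub_mem]
  have hab : Ideal.Quotient.mk (Ideal.span {(X a - X b : MvPolynomial σ ℤ)}) (X a) =
      Ideal.Quotient.mk (Ideal.span {(X a - X b : MvPolynomial σ ℤ)}) (X b) :=
    (Ideal.Quotient.mk_eq_mk_iff_sub_mem _ _).mpr (Ideal.mem_span_singleton_self _)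
  have key : (Ideal.Quotient.mk (Ideal.span {(X a - X b : MvPolynomial σ ℤ)})) =
      (Ideal.Quotient.mk (Ideal.span {(X a - X b : MvPolynomial σ ℤ)})).comp
        (rename (swap a b) : MvPolynomial σ ℤ →ₐ[ℤ] MvPolynomial σ ℤ).toRingHom := by
    apply MvPolynomial.ringHom_ext
    · intro r
      simp
    · intro i
      simp only [AlgHom.toRingHom_eq_coe, RingHom.coe_comp, RingHom.coe_coe, Function.comp_apply,
        rename_X]
      rw [swap_apply_def]
      split_ifs with h1 h2
      · rw [h1, hab]
      · rw [h2, hab]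
      · rfl
  exact RingHom.congr_fun key f

/-- The divided difference `(f - s f) / (x_a - x_b)`, where `s` interchanges the variables `x_a`
and `x_b` (intended for `a ≠ b`); it is the quotient in the polynomial ring, see
`divDiff_spec`. -/
noncomputable def divDiff {σ : Type} [DecidableEq σ] (a b : σ) (f : MvPolynomial σ ℤ) :
    MvPolynomial σ ℤ :=
  Classical.choose (X_sub_X_dvd_sub_rename_swap a b f)

theorem divDiff_spec {σ : Type} [DecidableEq σ] (a b : σ) (f : MvPolynomial σ ℤ) :
    f - rename (swap a b) f = (X a - X b) * divDiff a b f :=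
  Classical.choose_spec (X_sub_X_dvd_sub_rename_swap a b f)

/-- The isobaric divided difference `π_i f = δ_i f + δ_i (x_{i+1} f)` with respect to variables
`x_0, …, x_n` out of the set `σ` of all variables; the remaining variables are scalars. -/
noncomputable def piOp {σ : Type} [DecidableEq σ] {n : ℕ} (x : Fin (n + 1) → σ) (i : Fin n)
    (f : MvPolynomial σ ℤ) : MvPolynomial σ ℤ :=
  divDiff (x i.castSucc) (x i.succ) f + divDiff (x i.castSucc) (x i.succ) (X (x i.succ) * f)

/-- The operator `π_{i_1} ⋯ π_{i_k}` of a word. -/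
noncomputable def piWord {σ : Type} [DecidableEq σ] {n : ℕ} (x : Fin (n + 1) → σ)
    (a : List (Fin n)) (f : MvPolynomial σ ℤ) : MvPolynomial σ ℤ :=
  a.foldr (piOp x) f

/-- The operator `π_w`, computed along a reduced word of `w` (by the braid relations it does not
depend on which one). -/
noncomputable def piPerm {σ : Type} [DecidableEq σ] {n : ℕ} (x : Fin (n + 1) → σ)
    (w : Perm (Fin (n + 1))) (f : MvPolynomial σ ℤ) : MvPolynomial σ ℤ :=
  piWord x (Classical.choose (exists_isReducedWord w)) f

/-- The Grothendieck polynomial `𝔊_w = π_{w⁻¹ w₀} (x_1^n x_2^{n-1} ⋯ x_{n+1}^0)`. -/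
noncomputable def grothendieck {n : ℕ} (w : Perm (Fin (n + 1))) :
    MvPolynomial (Fin (n + 1)) ℤ :=
  piPerm (fun i => i) (w⁻¹ * longestPerm n) (∏ i : Fin (n + 1), X i ^ (n - (i : ℕ)))

/-- The polynomial ring `ℤ[x_1, …, x_{n+1}, y_1, …, y_{n+1}]`. -/
abbrev XYPoly (n : ℕ) : Type := MvPolynomial (Fin (n + 1) ⊕ Fin (n + 1)) ℤ

/-- The variable `x_{i+1}` (indices start at `0`). -/
noncomputable def xVar {n : ℕ} (i : Fin (n + 1)) : XYPoly n := X (Sum.inl i)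

/-- The variable `y_{i+1}` (indices start at `0`). -/
noncomputable def yVar {n : ℕ} (i : Fin (n + 1)) : XYPoly n := X (Sum.inr i)

/-- The polynomial `f(x)`, for `f` in one set of variables. -/
noncomputable def inX {n : ℕ} (f : MvPolynomial (Fin (n + 1)) ℤ) : XYPoly n := rename Sum.inl f

/-- The polynomial `f(y)`, for `f` in one set of variables. -/
noncomputable def inY {n : ℕ} (f : MvPolynomial (Fin (n + 1)) ℤ) : XYPoly n := rename Sum.inr f

/-- The double Grothendieck polynomial
`𝔊_w(x, y) = π_{w⁻¹ w₀} (∏_{i + j ≤ n + 1} (x_i + y_j + x_i y_j))`, where the operators act on the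
`x`-variables. With indices starting at `0`, the condition `i + j ≤ n + 1` reads
`i + j + 2 ≤ n + 1`. -/
noncomputable def doubleGrothendieck {n : ℕ} (w : Perm (Fin (n + 1))) : XYPoly n :=
  piPerm Sum.inl (w⁻¹ * longestPerm n)
    (∏ p : Fin (n + 1) × Fin (n + 1) with (p.1 : ℕ) + (p.2 : ℕ) + 2 ≤ n + 1,
      (xVar p.1 + yVar p.2 + xVar p.1 * yVar p.2))

end Polynomials

/-! ## Circled Hecke factorizations -/

/-- A letter, circled (second component `true`) or not. -/
abbrev CircledLetter (n : ℕ) : Type := Fin n × Bool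

/-- The strict order `① < 1 < ② < 2 < ⋯ < ⓝ < n`. -/
def circledLT {n : ℕ} (c d : CircledLetter n) : Prop :=
  c.1 < d.1 ∨ (c.1 = d.1 ∧ c.2 = true ∧ d.2 = false)

/-- The bounded circled Hecke factorizations of `w`: sequences of `n + 1` decreasing factors in
the circled and uncircled letters, all letters of the `k`-th factor being `≥ ⓚ`, which after
erasing circles and parentheses give a Hecke word for `w`. -/
def boundedCircled {n : ℕ} (w : Perm (Fin (n + 1))) :
    Set (Fin (n + 1) → List (CircledLetter n)) :=
  {f | (∀ k, (f k).Pairwise fun c d => circledLT d c) ∧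
    (∀ k, ∀ c ∈ f k, (k : ℕ) ≤ (c.1 : ℕ)) ∧
    IsHeckeWord ((List.ofFn f).flatten.map Prod.fst) w}

/-- The `i`-th entry of the `x`-weight: the number of uncircled letters in the `i`-th factor. -/
def circledXWeight {n : ℕ} (f : Fin (n + 1) → List (CircledLetter n)) (i : Fin (n + 1)) : ℕ :=
  (f i).countP fun c => !c.2

/-- The `i`-th entry of the `y`-weight: the number of circled letters which have some value `j` and
appear in some factor `k` with `j - k + 1 = i`. With indices starting at `0` for letters, factors
and entries this reads `j = k + i`. -/
def circledYWeight {n : ℕ} (f : Fin (n + 1) → List (CircledLetter n)) (i : Fin (n + 1)) : ℕ :=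
  ∑ k : Fin (n + 1), (f k).countP fun c => c.2 && decide ((c.1 : ℕ) = (k : ℕ) + (i : ℕ))

theorem finite_pi_nodup {ι α : Type} [Finite ι] [Finite α] (S : Set (ι → List α))
    (h : ∀ f ∈ S, ∀ k, (f k).Nodup) : S.Finite := by
  classical
  have := Fintype.ofFinite α
  have h1 : {l : List α | l.Nodup}.Finite :=
    Set.finite_coe_iff.mp (inferInstanceAs (Finite {l : List α // l.Nodup}))
  exact (Set.Finite.pi' fun _ : ι => h1).subset fun f hf k => h f hf k

theorem boundedCircled_finite {n : ℕ} (w : Perm (Fin (n + 1))) : (boundedCircled w).Finite := by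
  refine finite_pi_nodup _ fun f hf k => (hf.1 k).imp ?_
  rintro c d h rfl
  rcases h with h | ⟨_, h1, h2⟩
  · exact lt_irrefl _ h
  · rw [h1] at h2
    exact Bool.noConfusion h2

/-! ## Double Hecke factorizations -/

/-- The bounded double Hecke factorizations of `w`, written
`(g_{n+1}) ⋯ (g_2)(g_1) | (h_1)(h_2) ⋯ (h_{n+1})` and encoded as pairs `(g, h)`: the factor `g_i`,
the `i`-th to the left of center, is increasing, the factor `h_i`, the `i`-th to the right of
center, is decreasing, both have only letters `≥ i`, and erasing the parentheses gives a Hecke word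
for `w`. -/
def boundedDouble {n : ℕ} (w : Perm (Fin (n + 1))) :
    Set ((Fin (n + 1) → List (Fin n)) × (Fin (n + 1) → List (Fin n))) :=
  {p | (∀ i, (p.1 i).Pairwise (· < ·)) ∧ (∀ i, (p.2 i).Pairwise (· > ·)) ∧
    (∀ i, ∀ c ∈ p.1 i, (i : ℕ) ≤ (c : ℕ)) ∧ (∀ i, ∀ c ∈ p.2 i, (i : ℕ) ≤ (c : ℕ)) ∧
    IsHeckeWord ((List.ofFn p.1).reverse.flatten ++ (List.ofFn p.2).flatten) w}

/-- The `i`-th entry of the `x`-weight: the number of letters in the `i`-th factor to the right of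
center. -/
def doubleXWeight {n : ℕ} (p : (Fin (n + 1) → List (Fin n)) × (Fin (n + 1) → List (Fin n)))
    (i : Fin (n + 1)) : ℕ := (p.2 i).length

/-- The `i`-th entry of the `y`-weight: the number of letters in the `i`-th factor to the left of
center. -/
def doubleYWeight {n : ℕ} (p : (Fin (n + 1) → List (Fin n)) × (Fin (n + 1) → List (Fin n)))
    (i : Fin (n + 1)) : ℕ := (p.1 i).length

theorem boundedDouble_finite {n : ℕ} (w : Perm (Fin (n + 1))) : (boundedDouble w).Finite := by
  have h : {f : Fin (n + 1) → List (Fin n) | ∀ k, (f k).Nodup}.Finite :=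
    finite_pi_nodup _ fun f hf k => hf k
  refine (h.prod h).subset fun p hp => ⟨fun k => ?_, fun k => ?_⟩
  · exact (hp.1 k).imp fun h => ne_of_lt h
  · exact (hp.2.1 k).imp fun h => ne_of_gt h

/-- The monomial `x^a y^b`. -/
noncomputable def xyMonomial {n : ℕ} (a b : Fin (n + 1) → ℕ) : XYPoly n :=
  (∏ i, xVar i ^ a i) * ∏ i, yVar i ^ b i

/-!
The proof takes place in the 0-Hecke algebra of `S_{n+1}`, the monoid algebra of the 0-Hecke monoid:
its basis consists of the permutations, and its generators satisfy `u_j² = u_j` and the braid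
relations. A sequence of letters is a Hecke word for `w` exactly if the corresponding product of
generators is the basis element `w`, so all three right hand sides are coefficients of products of
factors `1 + z u_j` with `z` a polynomial.

Let `A_k(z) = (1 + z u_{n-1}) ⋯ (1 + z u_k)` and write `x ⊕ y` for `x + y + x y`.

* Expanding `(1 + x u_j) (1 + y u_j) = 1 + (x ⊕ y) u_j` shows that the circled factorizations
  enumerate the coefficients of the product over `k = 0, …, n` of the rows
  `∏_{j = n-1, …, k} (1 + (x_k ⊕ y_{j-k}) u_j)`. The double factorizations enumerate those of the
  mirror image of `∏_k A_k(y_k)` times `∏_k A_k(x_k)`. The two products agree by the Yang–Baxter equation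
  (`IsHeckeFamily.ascRowProd_mul_rowProd`).
* For fixed `k`, the elements `A_k(p)` and `A_k(q)` commute (`IsHeckeFamily.descProd_mul_comm`).
  This determines how `E = ∏_k A_k(x_k)` changes when `x_i` and `x_{i+1}` are exchanged
  (`IsHeckeFamily.rowProd_swap`), and the result reads `π_i E = E (u_i - 1)`. Taking coefficients,
  `π_i` sends the coefficient of `w` to that of `w s_i` whenever this has fewer inversions
  (`piOp_coeff`). A factor to the left of `E` without `x`-variables does no harm.
* The product of the rows has as many factors as the longest permutation has inversions, so the
  coefficient of that permutation is the product of all the `x_k ⊕ y_{j-k}`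
  (`coeff_rowProd_longestPerm`). This is the polynomial from which the double Grothendieck
  polynomials start; for `y = 0` it is the one from which the Grothendieck polynomials start.

Hence the double Grothendieck polynomials are the coefficients of both products, and the ordinary
ones are the coefficients of `∏_k A_k(x_k)`. As inversion of permutations is an anti-automorphism
of the 0-Hecke algebra, multiplying out the two factors of the second product gives the sum over
`heckePairs`.
-/

/-! ### The 0-Hecke monoid on permutations -/

@[simp] theorem adjSwap_mul_self {n : ℕ} (i : Fin n) : adjSwap i * adjSwap i = 1 := by
  simp [adjSwap]

@[simp] theorem adjSwap_inv {n : ℕ} (i : Fin n) : (adjSwap i)⁻¹ = adjSwap i := by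
  simp [adjSwap]

@[simp] theorem adjSwap_castSucc {n : ℕ} (i : Fin n) : adjSwap i i.castSucc = i.succ := by
  simp [adjSwap]

@[simp] theorem adjSwap_succ {n : ℕ} (i : Fin n) : adjSwap i i.succ = i.castSucc := by
  simp [adjSwap]

theorem invCount_inv {m : ℕ} (w : Perm (Fin m)) : invCount w⁻¹ = invCount w := by
  unfold invCount
  refine Finset.card_nbij' (fun p => (w⁻¹ p.2, w⁻¹ p.1)) (fun p => (w p.2, w p.1)) ?_ ?_ ?_ ?_
  all_goals
    rintro ⟨p, q⟩ h
    simp at h ⊢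
    try tauto

theorem invCount_one {m : ℕ} : invCount (1 : Perm (Fin m)) = 0 := by
  unfold invCount
  rw [Finset.card_eq_zero, Finset.filter_eq_empty_iff]
  rintro ⟨p, q⟩ _ ⟨h1, h2⟩
  exact lt_asymm h1 h2

theorem invCount_adjSwap_mul {n : ℕ} (w : Perm (Fin (n + 1))) (i : Fin n)
    (hi : w⁻¹ i.castSucc < w⁻¹ i.succ) : invCount (adjSwap i * w) = invCount w + 1 := by
  have h := invCount_mul_adjSwap (w⁻¹ * adjSwap i) i (by simpa using hi)
  rw [mul_assoc, adjSwap_mul_self, mul_one, invCount_inv] at h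
  rw [← h, ← invCount_inv]
  simp

theorem apply_castSucc_lt_or_gt {n : ℕ} (w : Perm (Fin (n + 1))) (i : Fin n) :
    w i.castSucc < w i.succ ∨ w i.succ < w i.castSucc :=
  lt_or_gt_of_ne fun h => (Fin.castSucc_lt_succ (i := i)).ne (w.injective h)

theorem invCount_adjSwap_mul_le {n : ℕ} (w : Perm (Fin (n + 1))) (i : Fin n) :
    invCount (adjSwap i * w) ≤ invCount w + 1 := by
  rcases apply_castSucc_lt_or_gt w⁻¹ i with h | h
  · exact (invCount_adjSwap_mul w i h).le
  · have := invCount_adjSwap_mul (adjSwap i * w) i (by simpa using h)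
    rw [← mul_assoc, adjSwap_mul_self, one_mul] at this
    omega

theorem invCount_wordProd_le {n : ℕ} (a : List (Fin n)) : invCount (wordProd a) ≤ a.length := by
  induction a with
  | nil => simp [wordProd, invCount_one]
  | cons i a ih =>
    have := invCount_adjSwap_mul_le (wordProd a) i
    simp only [wordProd, List.map_cons, List.prod_cons, List.length_cons] at this ih ⊢
    omega

/-- A tail of a reduced word is reduced, and its head raises the inversion number. -/
theorem IsReducedWord.of_cons {n : ℕ} {i : Fin n} {a : List (Fin n)} {v : Perm (Fin (n + 1))}
    (h : IsReducedWord (i :: a) v) :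
    IsReducedWord a (wordProd a) ∧ v = adjSwap i * wordProd a ∧
      (wordProd a)⁻¹ i.castSucc < (wordProd a)⁻¹ i.succ := by
  obtain ⟨rfl, hl⟩ := h
  have hv : wordProd (i :: a) = adjSwap i * wordProd a := by simp [wordProd]
  have hle := invCount_wordProd_le a
  rw [hv, List.length_cons] at hl
  rcases apply_castSucc_lt_or_gt (wordProd a)⁻¹ i with h | h
  · have := invCount_adjSwap_mul _ i h
    exact ⟨⟨rfl, by omega⟩, hv, h⟩
  · have := invCount_adjSwap_mul (adjSwap i * wordProd a) i (by simpa using h)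
    rw [← mul_assoc, adjSwap_mul_self, one_mul] at this
    omega

theorem IsReducedWord.isHeckeWord {n : ℕ} {a : List (Fin n)} {v : Perm (Fin (n + 1))}
    (h : IsReducedWord a v) : IsHeckeWord a v := by
  induction a generalizing v with
  | nil => exact h.1
  | cons i a ih =>
    obtain ⟨h1, rfl, h3⟩ := h.of_cons
    have := ih h1
    unfold IsHeckeWord at this ⊢
    rw [List.foldr_cons, this, heckeAct, if_pos h3]

theorem invCount_heckeAct_le {n : ℕ} (i : Fin n) (w : Perm (Fin (n + 1))) :
    invCount (heckeAct i w) ≤ invCount w + 1 := by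
  unfold heckeAct
  split_ifs with h
  · exact (invCount_adjSwap_mul w i h).le
  · omega

/-- The mirror image of `heckeAct`: multiplication by `s_i` from the right, if this raises the
inversion number. -/
def heckeActRight {n : ℕ} (i : Fin n) (w : Perm (Fin (n + 1))) : Perm (Fin (n + 1)) :=
  if w i.castSucc < w i.succ then w * adjSwap i else w

theorem heckeActRight_eq {n : ℕ} (i : Fin n) (w : Perm (Fin (n + 1))) :
    heckeActRight i w = (heckeAct i w⁻¹)⁻¹ := by
  by_cases h : w i.castSucc < w i.succ
  · rw [heckeActRight, if_pos h, heckeAct, if_pos (by simpa using h), mul_inv_rev, inv_inv,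
      adjSwap_inv]
  · rw [heckeActRight, if_neg h, heckeAct, if_neg (by simpa using h), inv_inv]

theorem heckeAct_one {n : ℕ} (i : Fin n) : heckeAct i 1 = adjSwap i := by
  simp [heckeAct]

theorem heckeActRight_one {n : ℕ} (i : Fin n) : heckeActRight i 1 = adjSwap i := by
  simp [heckeActRight]

theorem adjSwap_lt_iff {n : ℕ} (i : Fin n) {p q : Fin (n + 1)}
    (h1 : ¬(p = i.castSucc ∧ q = i.succ)) (h2 : ¬(q = i.castSucc ∧ p = i.succ)) :
    adjSwap i p < adjSwap i q ↔ p < q := by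
  refine ⟨fun h => ?_, fun h => adjSwap_lt i h h1⟩
  rcases lt_trichotomy p q with h3 | h3 | h3
  · exact h3
  · exact absurd h (by simp [h3])
  · exact absurd h (adjSwap_lt i h3 h2).not_gt

theorem adjSwap_mul_eq_mul_adjSwap {n : ℕ} (i j : Fin n) (w : Perm (Fin (n + 1)))
    (h : w j.castSucc = i.castSucc ∧ w j.succ = i.succ ∨
      w j.castSucc = i.succ ∧ w j.succ = i.castSucc) : adjSwap i * w = w * adjSwap j := by
  have : adjSwap i = w * adjSwap j * w⁻¹ := by
    unfold adjSwap
    rw [← swap_apply_apply]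
    rcases h with ⟨h1, h2⟩ | ⟨h1, h2⟩
    · rw [h1, h2]
    · rw [h1, h2, swap_comm]
  rw [this]
  group

/-- The left and the right action commute. They interfere only if `s_i w = w s_j`, and then both
compositions multiply by the transposition at most once. -/
theorem heckeAct_comm_heckeActRight {n : ℕ} (i j : Fin n) (w : Perm (Fin (n + 1))) :
    heckeAct i (heckeActRight j w) = heckeActRight j (heckeAct i w) := by
  by_cases h : w j.castSucc = i.castSucc ∧ w j.succ = i.succ ∨
      w j.castSucc = i.succ ∧ w j.succ = i.castSucc
  · have he := adjSwap_mul_eq_mul_adjSwap i j w h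
    rcases h with ⟨h1, h2⟩ | ⟨h1, h2⟩
    · have h3 : w⁻¹ i.castSucc = j.castSucc := by simp [← h1]
      have h4 : w⁻¹ i.succ = j.succ := by simp [← h2]
      simp only [heckeAct, heckeActRight, h1, h2, h3, h4, Fin.castSucc_lt_succ, if_true,
        mul_inv_rev, Perm.mul_apply, adjSwap_inv, adjSwap_castSucc, adjSwap_succ,
        if_neg (Fin.castSucc_lt_succ (i := _)).not_gt, he]
    · have h3 : w⁻¹ i.castSucc = j.succ := by simp [← h2]
      have h4 : w⁻¹ i.succ = j.castSucc := by simp [← h1]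
      simp [heckeAct, heckeActRight, h1, h2, h3, h4, Fin.castSucc_lt_succ.not_gt]
  · push Not at h
    have e1 : (w * adjSwap j)⁻¹ i.castSucc < (w * adjSwap j)⁻¹ i.succ ↔
        w⁻¹ i.castSucc < w⁻¹ i.succ := by
      simp only [mul_inv_rev, Perm.mul_apply, adjSwap_inv]
      refine adjSwap_lt_iff j ?_ ?_
      · rintro ⟨h1, h2⟩
        exact h.1 (by simp [← h1]) (by simp [← h2])
      · rintro ⟨h1, h2⟩
        exact h.2 (by simp [← h1]) (by simp [← h2])
    have e2 : (adjSwap i * w) j.castSucc < (adjSwap i * w) j.succ ↔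
        w j.castSucc < w j.succ := by
      simp only [Perm.mul_apply]
      exact adjSwap_lt_iff i (fun h' => h.1 h'.1 h'.2) (fun h' => h.2 h'.2 h'.1)
    unfold heckeActRight
    by_cases h1 : w j.castSucc < w j.succ <;> by_cases h2 : w⁻¹ i.castSucc < w⁻¹ i.succ
    · rw [if_pos h1, heckeAct, if_pos (e1.2 h2), heckeAct, if_pos h2, if_pos (e2.2 h1), mul_assoc]
    · rw [if_pos h1, heckeAct, if_neg (mt e1.1 h2), heckeAct, if_neg h2, if_pos h1]
    · rw [if_neg h1, heckeAct, if_pos h2, if_neg (mt e2.1 h1)]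
    · rw [if_neg h1, heckeAct, if_neg h2, if_neg h1]

theorem foldr_heckeAct_heckeActRight {n : ℕ} (a : List (Fin n)) (j : Fin n)
    (w : Perm (Fin (n + 1))) :
    a.foldr heckeAct (heckeActRight j w) = heckeActRight j (a.foldr heckeAct w) := by
  induction a with
  | nil => rfl
  | cons i a ih => rw [List.foldr_cons, ih, heckeAct_comm_heckeActRight, List.foldr_cons]

/-- A Hecke word may also be evaluated from left to right, by multiplications from the right. -/
theorem foldr_heckeAct_append {n : ℕ} (a b : List (Fin n)) :
    (a ++ b).foldr heckeAct 1 = b.foldl (fun w i => heckeActRight i w) (a.foldr heckeAct 1) := by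
  induction b using List.reverseRecOn with
  | nil => simp
  | append_singleton b i ih =>
    rw [List.foldl_append, ← ih, ← List.append_assoc, List.foldr_append, List.foldr_cons,
      List.foldr_nil, heckeAct_one, ← heckeActRight_one, foldr_heckeAct_heckeActRight]
    rfl

theorem foldr_heckeAct_reverse {n : ℕ} (a : List (Fin n)) :
    a.reverse.foldr heckeAct 1 = (a.foldr heckeAct 1)⁻¹ := by
  have key : ∀ w : Perm (Fin (n + 1)), a.reverse.foldl (fun w i => heckeActRight i w) w =
      (a.foldr heckeAct w⁻¹)⁻¹ := by
    intro w
    rw [List.foldl_reverse]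
    induction a with
    | nil => simp
    | cons i a ih => rw [List.foldr_cons, List.foldr_cons, ih, heckeActRight_eq, inv_inv]
  have := foldr_heckeAct_append [] a.reverse
  rw [List.nil_append, List.foldr_nil, key, inv_one] at this
  exact this

/-- The 0-Hecke monoid of `S_{n+1}`: the set of permutations with the Demazure product, for which
the product of two permutations is evaluated by concatenating Hecke words. -/
def HeckeMonoid (n : ℕ) : Type := Perm (Fin (n + 1))

namespace HeckeMonoid

variable {n : ℕ}

instance : DecidableEq (HeckeMonoid n) := inferInstanceAs (DecidableEq (Perm (Fin (n + 1))))

instance : Fintype (HeckeMonoid n) := inferInstanceAs (Fintype (Perm (Fin (n + 1))))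

/-- A permutation as an element of the 0-Hecke monoid. -/
def of (w : Perm (Fin (n + 1))) : HeckeMonoid n := w

/-- The permutation underlying an element of the 0-Hecke monoid. -/
def perm (w : HeckeMonoid n) : Perm (Fin (n + 1)) := w

@[simp] theorem perm_of (w : Perm (Fin (n + 1))) : (of w).perm = w := rfl

@[simp] theorem of_perm (w : HeckeMonoid n) : of w.perm = w := rfl

/-- The element of the 0-Hecke monoid that a word evaluates to. -/
def eval (a : List (Fin n)) : HeckeMonoid n := of (a.foldr heckeAct 1)

theorem exists_eval (w : HeckeMonoid n) : ∃ a, eval a = w :=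
  (exists_isReducedWord w.perm).imp fun _ h => h.isHeckeWord

/-- The Demazure product, evaluated along chosen words; `eval_append` shows that the choice does not
matter. -/
noncomputable instance : Mul (HeckeMonoid n) :=
  ⟨fun u v => eval (u.exists_eval.choose ++ v.exists_eval.choose)⟩

theorem eval_append (a b : List (Fin n)) : eval (a ++ b) = eval a * eval b := by
  have ha := (exists_eval (eval a)).choose_spec
  have hb := (exists_eval (eval b)).choose_spec
  change _ = eval ((exists_eval (eval a)).choose ++ (exists_eval (eval b)).choose)
  set a' := (exists_eval (eval a)).choose
  set b' := (exists_eval (eval b)).choose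
  have h1 : a'.foldr heckeAct 1 = a.foldr heckeAct 1 := ha
  have h2 : b'.foldr heckeAct 1 = b.foldr heckeAct 1 := hb
  change (a ++ b).foldr heckeAct 1 = (a' ++ b').foldr heckeAct 1
  rw [foldr_heckeAct_append, ← h1, ← foldr_heckeAct_append, List.foldr_append, ← h2,
    ← List.foldr_append]

noncomputable instance : Monoid (HeckeMonoid n) where
  one := eval []
  one_mul u := by
    obtain ⟨a, rfl⟩ := u.exists_eval
    exact (eval_append [] a).symm
  mul_one u := by
    obtain ⟨a, rfl⟩ := u.exists_eval
    exact (eval_append a []).symm.trans (by rw [List.append_nil])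
  mul_assoc u v w := by
    obtain ⟨a, rfl⟩ := u.exists_eval
    obtain ⟨b, rfl⟩ := v.exists_eval
    obtain ⟨c, rfl⟩ := w.exists_eval
    simp only [← eval_append, List.append_assoc]

theorem eval_nil : eval ([] : List (Fin n)) = 1 := rfl

/-- The generator `s_i` of the 0-Hecke monoid. -/
def gen (i : Fin n) : HeckeMonoid n := eval [i]

theorem eval_eq_prod (a : List (Fin n)) : eval a = (a.map gen).prod := by
  induction a with
  | nil => rfl
  | cons i a ih => rw [List.map_cons, List.prod_cons, ← ih, gen, ← eval_append]; rfl

theorem gen_mul (i : Fin n) (w : HeckeMonoid n) : gen i * w = of (heckeAct i w.perm) := by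
  obtain ⟨a, rfl⟩ := w.exists_eval
  rw [gen, ← eval_append]
  rfl

theorem mul_gen (w : HeckeMonoid n) (i : Fin n) : w * gen i = of (heckeActRight i w.perm) := by
  obtain ⟨a, rfl⟩ := w.exists_eval
  rw [gen, ← eval_append]
  exact foldr_heckeAct_append a [i]

theorem gen_eq (i : Fin n) : gen i = of (adjSwap i) := heckeAct_one i

theorem gen_mul_self (i : Fin n) : gen i * gen i = gen i := by
  rw [gen_mul, gen_eq]
  simp [heckeAct, Fin.castSucc_lt_succ.not_gt]

theorem gen_mul_gen_comm {i j : Fin n} (h : (i : ℕ) + 2 ≤ j) :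
    gen i * gen j = gen j * gen i := by
  rw [gen_mul, mul_gen, gen_eq]
  have h1 : adjSwap j i.castSucc = i.castSucc :=
    swap_apply_of_ne_of_ne (by simp [Fin.ext_iff]; omega) (by simp [Fin.ext_iff]; omega)
  have h2 : adjSwap j i.succ = i.succ :=
    swap_apply_of_ne_of_ne (by simp [Fin.ext_iff]; omega) (by simp [Fin.ext_iff]; omega)
  have h3 := adjSwap_mul_eq_mul_adjSwap i i (adjSwap j) (Or.inl ⟨h1, h2⟩)
  rw [perm_of, heckeAct, heckeActRight, adjSwap_inv, h1, h2,
    if_pos Fin.castSucc_lt_succ, if_pos Fin.castSucc_lt_succ, h3]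

theorem gen_braid {i j : Fin n} (h : (j : ℕ) = i + 1) :
    gen i * gen j * gen i = gen j * gen i * gen j := by
  have hij : j.castSucc = i.succ := by simp [Fin.ext_iff, h]
  have a1 : adjSwap i j.succ = j.succ :=
    swap_apply_of_ne_of_ne (by simp [Fin.ext_iff]; omega) (by simp [Fin.ext_iff]; omega)
  have a2 : adjSwap j i.castSucc = i.castSucc :=
    swap_apply_of_ne_of_ne (by simp [Fin.ext_iff]; omega) (by simp [Fin.ext_iff]; omega)
  have a3 : adjSwap j i.succ = j.succ := by rw [← hij, adjSwap_castSucc]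
  have a4 : adjSwap j j.succ = i.succ := by rw [← hij, adjSwap_succ]
  have l1 : i.castSucc < j.succ := by rw [Fin.lt_def, Fin.val_castSucc, Fin.val_succ]; omega
  have l2 : i.succ < j.succ := by rw [Fin.lt_def, Fin.val_succ, Fin.val_succ]; omega
  have e : adjSwap j * (adjSwap i * adjSwap j) = adjSwap i * (adjSwap j * adjSwap i) := by
    rw [← mul_assoc]
    exact (adjSwap_mul_eq_mul_adjSwap i j (adjSwap j * adjSwap i)
      (by simp [hij, a1, a2, a4])).symm
  have b1 : heckeAct i (heckeAct j (adjSwap i)) = adjSwap i * (adjSwap j * adjSwap i) := by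
    have : heckeAct j (adjSwap i) = adjSwap j * adjSwap i := by
      rw [heckeAct, if_pos (by simpa [hij, a1] using l1)]
    rw [this, heckeAct, if_pos (by simpa [a2, a3, a1] using l2)]
  have b2 : heckeAct j (heckeAct i (adjSwap j)) = adjSwap j * (adjSwap i * adjSwap j) := by
    have : heckeAct i (adjSwap j) = adjSwap i * adjSwap j := by
      rw [heckeAct, if_pos (by simpa [a2, a3] using l1)]
    rw [this, heckeAct, if_pos (by simp [hij, a1, a2, a4])]
  rw [mul_assoc, mul_assoc, gen_mul i, gen_mul j (gen i), gen_mul j, gen_mul i (gen j), gen_eq,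
    gen_eq, perm_of, perm_of, perm_of, perm_of, b1, b2, e]

theorem isHeckeWord_iff {a : List (Fin n)} {w : Perm (Fin (n + 1))} :
    IsHeckeWord a w ↔ eval a = of w := Iff.rfl

theorem mem_heckePairs_iff {w : Perm (Fin (n + 1))}
    {p : Perm (Fin (n + 1)) × Perm (Fin (n + 1))} :
    p ∈ heckePairs w ↔ of p.1 * of p.2 = of w := by
  constructor
  · rintro ⟨a, b, h1, h2, h3⟩
    rw [isHeckeWord_iff] at h1 h2 h3
    rw [← h1, ← h2, ← eval_append, h3]
  · intro h
    obtain ⟨a, ha⟩ := (of p.1).exists_eval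
    obtain ⟨b, hb⟩ := (of p.2).exists_eval
    exact ⟨a, b, ha, hb, by rw [isHeckeWord_iff, eval_append, ha, hb, h]⟩

theorem gen_mul_longestPerm (i : Fin n) :
    gen i * of (longestPerm n) = of (longestPerm n) := by
  rw [gen_mul, heckeAct, if_neg]
  · rfl
  · simp [of, perm, longestPerm, Fin.lt_def, Perm.inv_def]
    omega

/-- An element that absorbs all generators from the right is the longest permutation. -/
theorem eq_longestPerm {w : HeckeMonoid n} (h : ∀ i, w * gen i = w) : w = of (longestPerm n) := by
  have h1 : ∀ a, w * eval a = w := by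
    intro a
    induction a with
    | nil => rw [eval_nil, mul_one]
    | cons i a ih =>
      rw [eval_eq_prod, List.map_cons, List.prod_cons, ← mul_assoc, h, ← eval_eq_prod, ih]
  have h2 : ∀ a, eval a * of (longestPerm n) = of (longestPerm n) := by
    intro a
    induction a with
    | nil => rw [eval_nil, one_mul]
    | cons i a ih =>
      rw [eval_eq_prod, List.map_cons, List.prod_cons, mul_assoc, ← eval_eq_prod, ih,
        gen_mul_longestPerm]
  obtain ⟨a, ha⟩ := w.exists_eval
  obtain ⟨b, hb⟩ := (of (longestPerm n)).exists_eval
  rw [← h1 b, hb, ← ha, h2]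

theorem inv_eval (a : List (Fin n)) : of (eval a).perm⁻¹ = eval a.reverse :=
  (foldr_heckeAct_reverse a).symm

/-- Inversion of permutations is an anti-automorphism of the 0-Hecke monoid. -/
theorem of_inv_mul (u v : HeckeMonoid n) :
    of (u * v).perm⁻¹ = of v.perm⁻¹ * of u.perm⁻¹ := by
  obtain ⟨a, rfl⟩ := u.exists_eval
  obtain ⟨b, rfl⟩ := v.exists_eval
  rw [← eval_append, inv_eval, inv_eval, inv_eval, List.reverse_append, eval_append]

end HeckeMonoid

/-! ### Products of the factors `1 + z u_j` -/

/-- The relations of the 0-Hecke monoid for a sequence of elements. -/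
structure IsHeckeFamily {A : Type*} [Monoid A] (u : ℕ → A) : Prop where
  mul_self : ∀ i, u i * u i = u i
  braid : ∀ i, u i * u (i + 1) * u i = u (i + 1) * u i * u (i + 1)
  comm : ∀ i j, i + 2 ≤ j → u i * u j = u j * u i

theorem IsHeckeFamily.map {A B : Type*} [Monoid A] [Monoid B] {u : ℕ → A} (hu : IsHeckeFamily u)
    (f : A →* B) : IsHeckeFamily fun i => f (u i) where
  mul_self i := by rw [← map_mul, hu.mul_self]
  braid i := by simp only [← map_mul, hu.braid]
  comm i j h := by simp only [← map_mul, hu.comm i j h]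

section Monoid

variable {M : Type*} [Monoid M]

/-- The product `u_{m+l-1} ⋯ u_{m+1} u_m`. -/
def descWord (u : ℕ → M) (m l : ℕ) : M := ((List.range' m l).map u).reverse.prod

theorem descWord_succ (u : ℕ → M) (m l : ℕ) :
    descWord u m (l + 1) = descWord u (m + 1) l * u m := by
  simp [descWord, List.range'_succ]

theorem IsHeckeFamily.commute_descWord {u : ℕ → M} (hu : IsHeckeFamily u) {i m : ℕ}
    (h : i + 2 ≤ m) (l : ℕ) : Commute (u i) (descWord u m l) := by
  refine Commute.list_prod_right _ _ fun a ha => ?_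
  simp only [List.mem_reverse, List.mem_map, List.mem_range'_1] at ha
  obtain ⟨j, hj, rfl⟩ := ha
  exact hu.comm i j (by omega)

/-- After a descending word, the last letter of a second copy of it may be dropped. -/
theorem IsHeckeFamily.descWord_mul_self {u : ℕ → M} (hu : IsHeckeFamily u) (m l : ℕ) :
    descWord u m (l + 1) * descWord u m (l + 1) =
      descWord u m (l + 1) * descWord u (m + 1) l := by
  induction l generalizing m with
  | zero => simp [descWord, hu.mul_self]
  | succ l ih =>
    have hc := (hu.commute_descWord (le_refl (m + 2)) l).eq
    calc descWord u m (l + 2) * descWord u m (l + 2)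
        = descWord u (m + 1) (l + 1) * (u m * descWord u (m + 2) l) * u (m + 1) * u m := by
          simp only [descWord_succ u m (l + 1), descWord_succ u (m + 1) l, mul_assoc]
      _ = descWord u (m + 1) (l + 1) * descWord u (m + 2) l * (u m * u (m + 1) * u m) := by
          rw [hc]
          simp only [mul_assoc]
      _ = descWord u (m + 1) (l + 1) * descWord u (m + 1) (l + 1) * u m * u (m + 1) := by
          rw [hu.braid, descWord_succ u (m + 1) l]
          simp only [mul_assoc]
      _ = descWord u (m + 1) (l + 1) * (descWord u (m + 2) l * u m) * u (m + 1) := by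
          rw [ih, mul_assoc _ _ (u m)]
      _ = _ := by
          rw [← hc, descWord_succ u m (l + 1), descWord_succ u (m + 1) l]
          simp only [mul_assoc]

theorem range_succ_eq_append {n i : ℕ} (h : i < n) :
    List.range (n + 1) = List.range i ++ i :: (i + 1) :: List.range' (i + 2) (n - 1 - i) := by
  have := List.range'_append_1 (s := 0) (m := i) (n := n - 1 - i + 1 + 1)
  rw [Nat.zero_add, List.range'_succ, List.range'_succ, ← List.range_eq_range'] at this
  rw [this, List.range_eq_range']
  congr 1
  omega

/-- The product of the words `u_{n-1} ⋯ u_k` over `k = 0, …, n` absorbs the generators; this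
identifies its value in the 0-Hecke monoid as the longest permutation. -/
theorem IsHeckeFamily.prod_descWord_mul {u : ℕ → M} (hu : IsHeckeFamily u) {n i : ℕ} (h : i < n) :
    ((List.range (n + 1)).map fun k => descWord u k (n - k)).prod * u i =
      ((List.range (n + 1)).map fun k => descWord u k (n - k)).prod := by
  have hc : Commute (u i)
      ((List.range' (i + 2) (n - 1 - i)).map fun k => descWord u k (n - k)).prod := by
    refine Commute.list_prod_right _ _ fun a ha => ?_
    simp only [List.mem_map, List.mem_range'_1] at ha
    obtain ⟨j, hj, rfl⟩ := ha
    exact hu.commute_descWord (by omega) _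
  obtain ⟨l, hl⟩ : ∃ l, n - i = l + 1 := ⟨n - i - 1, by omega⟩
  rw [range_succ_eq_append h, List.map_append, List.prod_append, List.map_cons, List.map_cons,
    List.prod_cons, List.prod_cons, hl, show n - (i + 1) = l by omega]
  have key : descWord u i (l + 1) * (descWord u (i + 1) l * u i) =
      descWord u i (l + 1) * descWord u (i + 1) l := by
    rw [← descWord_succ, hu.descWord_mul_self]
  rw [mul_assoc, mul_assoc, mul_assoc, ← hc.eq, ← mul_assoc (descWord u (i + 1) l),
    ← mul_assoc (descWord u i (l + 1)), key, mul_assoc (descWord u i (l + 1))]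

end Monoid

section HeckeFamily

variable {R A : Type*} [CommRing R] [Ring A] [Algebra R A]

/-- The product `(1 + z_{m+l-1} u_{m+l-1}) ⋯ (1 + z_{m+1} u_{m+1}) (1 + z_m u_m)`. -/
def descProd (u : ℕ → A) (z : ℕ → R) (m l : ℕ) : A :=
  ((List.range' m l).map fun j => 1 + z j • u j).reverse.prod

/-- The product `(1 + z u_m) (1 + z u_{m+1}) ⋯ (1 + z u_{m+l-1})`. -/
def ascProd (u : ℕ → A) (z : R) (m l : ℕ) : A :=
  ((List.range' m l).map fun j => 1 + z • u j).prod

variable (u : ℕ → A)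

@[simp] theorem descProd_zero (z : ℕ → R) (m : ℕ) : descProd u z m 0 = 1 := rfl

theorem descProd_succ (z : ℕ → R) (m l : ℕ) :
    descProd u z m (l + 1) = descProd u z (m + 1) l * (1 + z m • u m) := by
  simp [descProd, List.range'_succ]

@[simp] theorem ascProd_zero (z : R) (m : ℕ) : ascProd u z m 0 = 1 := rfl

theorem ascProd_succ (z : R) (m l : ℕ) :
    ascProd u z m (l + 1) = (1 + z • u m) * ascProd u z (m + 1) l := by
  simp [ascProd, List.range'_succ]

variable {u} (hu : IsHeckeFamily u)
include hu

theorem IsHeckeFamily.commute_factor {i j : ℕ} (h : i + 2 ≤ j) (z : R) :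
    Commute (u i) (1 + z • u j) :=
  (Commute.one_right _).add_right ((show Commute (u i) (u j) from hu.comm i j h).smul_right z)

theorem IsHeckeFamily.commute_descProd {i m : ℕ} (h : i + 2 ≤ m) (z : ℕ → R) (l : ℕ) :
    Commute (u i) (descProd u z m l) := by
  refine Commute.list_prod_right _ _ fun a ha => ?_
  simp only [List.mem_reverse, List.mem_map, List.mem_range'_1] at ha
  obtain ⟨j, hj, rfl⟩ := ha
  exact hu.commute_factor (by omega) _

theorem IsHeckeFamily.commute_ascProd {i m : ℕ} (h : i + 2 ≤ m) (z : R) (l : ℕ) :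
    Commute (u i) (ascProd u z m l) := by
  refine Commute.list_prod_right _ _ fun a ha => ?_
  simp only [List.mem_map, List.mem_range'_1] at ha
  obtain ⟨j, hj, rfl⟩ := ha
  exact hu.commute_factor (by omega) _

theorem IsHeckeFamily.factor_mul_factor (j : ℕ) (x y : R) :
    (1 + x • u j) * (1 + y • u j) = 1 + (x + y + x * y) • u j := by
  simp only [mul_add, add_mul, one_mul, mul_one, smul_mul_assoc, mul_smul_comm, hu.mul_self]
  module

/-- The Yang–Baxter equation. -/
theorem IsHeckeFamily.yangBaxter (j : ℕ) (x y : R) :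
    (1 + y • u j) * (1 + (x + y + x * y) • u (j + 1)) * (1 + x • u j) =
      (1 + x • u (j + 1)) * (1 + (x + y + x * y) • u j) * (1 + y • u (j + 1)) := by
  simp only [mul_add, add_mul, one_mul, mul_one, smul_mul_assoc, mul_smul_comm, hu.mul_self,
    hu.braid]
  module

theorem IsHeckeFamily.factor_mul_sub_one (j : ℕ) (x : R) :
    (1 + x • u j) * (u j - 1) = u j - 1 := by
  simp only [mul_sub, add_mul, one_mul, mul_one, smul_mul_assoc, hu.mul_self]
  module

/-- If `T (1 + q u)` is symmetric under exchanging `(T, q)` with `(T', p)`, then `T` satisfies the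
identity that turns into the action of an isobaric divided difference. -/
theorem IsHeckeFamily.sub_eq_of_mul_factor_eq {T T' : A} {p q : R} {i : ℕ}
    (h : T * (1 + q • u i) = T' * (1 + p • u i)) :
    (1 + q) • T - (1 + p) • T' = (p - q) • (T * (u i - 1)) ∧
      T * (u i - 1) = T' * (u i - 1) := by
  have hV : T * (u i - 1) = T' * (u i - 1) := by
    rw [← hu.factor_mul_sub_one i q, ← mul_assoc, h, mul_assoc, hu.factor_mul_sub_one,
      hu.factor_mul_sub_one]
  refine ⟨?_, hV⟩
  have e : ∀ (S : A) (r : R), S * (1 + r • u i) = (1 + r) • S + r • (S * (u i - 1)) := by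
    intro S r
    simp only [mul_add, mul_sub, mul_one, mul_smul_comm]
    module
  rw [e, e, ← hV] at h
  rw [sub_smul, eq_sub_iff_add_eq.mpr h]
  abel

/-- The decreasing products with constant parameters commute with each other. -/
theorem IsHeckeFamily.descProd_mul_comm (p q : R) (m l : ℕ) :
    descProd u (fun _ => p) m l * descProd u (fun _ => q) m l =
      descProd u (fun _ => q) m l * descProd u (fun _ => p) m l := by
  induction l generalizing m with
  | zero => simp
  | succ l ih =>
    rcases l with _ | l
    · simp only [descProd_succ, descProd_zero, one_mul]
      rw [hu.factor_mul_factor, hu.factor_mul_factor]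
      ring_nf
    · have key : ∀ p q : R, descProd u (fun _ => p) m (l + 2) * descProd u (fun _ => q) m (l + 2) =
          descProd u (fun _ => p) (m + 1) (l + 1) * descProd u (fun _ => q) (m + 2) l *
            ((1 + p • u m) * (1 + q • u (m + 1)) * (1 + q • u m)) := by
        intro p q
        have hc : (1 + p • u m) * descProd u (fun _ => q) (m + 2) l =
            descProd u (fun _ => q) (m + 2) l * (1 + p • u m) :=
          (Commute.one_left _).add_left ((hu.commute_descProd le_rfl _ l).smul_left p)
        rw [descProd_succ u _ m (l + 1), descProd_succ u _ m (l + 1),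
          descProd_succ u (fun _ => q) (m + 1) l]
        simp only [mul_assoc]
        rw [← mul_assoc (1 + p • u m) (descProd _ _ _ _), hc]
        simp only [mul_assoc]
      rw [key, key]
      have h := ih (m + 1)
      rw [descProd_succ u (fun _ => q) (m + 1) l, descProd_succ u (fun _ => p) (m + 1) l,
        ← mul_assoc, ← mul_assoc, ← descProd_succ u (fun _ => q) (m + 1) l,
        ← descProd_succ u (fun _ => p) (m + 1) l] at h
      set T := descProd u (fun _ => p) (m + 1) (l + 1) * descProd u (fun _ => q) (m + 2) l
      set T' := descProd u (fun _ => q) (m + 1) (l + 1) * descProd u (fun _ => p) (m + 2) l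
      obtain ⟨h1, h2⟩ := hu.sub_eq_of_mul_factor_eq h
      -- Written in terms of `T (1 + q)`, `T (1 + q u_{m+1})` and `V = T (u_{m+1} - 1)`, both sides
      -- differ only by multiples of the identities `h`, `h1`, `h2`.
      have e : ∀ (T : A) (p q : R), T * ((1 + p • u m) * (1 + q • u (m + 1)) * (1 + q • u m)) =
          T * (1 + q • u (m + 1)) + (p + q) • ((1 + q) • T * u m) +
            (p * q) • ((1 + q) • T * (u m * u (m + 1))) +
            (q * q) • (T * (u (m + 1) - 1) * u m) +
            (p * q * q) • (T * (u (m + 1) - 1) * (u m * u (m + 1))) := by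
        intro T p q
        have hb : u (m + 1) * (u m * u (m + 1)) = u m * (u (m + 1) * u m) := by
          rw [← mul_assoc, ← hu.braid, mul_assoc]
        simp only [mul_add, add_mul, one_mul, mul_one, smul_mul_assoc, mul_smul_comm, hu.mul_self,
          hb, mul_sub, sub_mul, mul_assoc]
        module
      rw [e T p q, e T' q p, ← h, ← h2, eq_add_of_sub_eq h1]
      simp only [add_mul, smul_mul_assoc]
      module

/-- The exchange relation for decreasing and increasing products. -/
theorem IsHeckeFamily.ascProd_mul_descProd (x y : R) (m l : ℕ) :
    ascProd u y m (l + 1) * descProd u (fun _ => x) m (l + 1) =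
      descProd u (fun _ => x) (m + 1) l * (1 + (x + y + x * y) • u m) *
        ascProd u y (m + 1) l := by
  induction l generalizing m with
  | zero =>
    simp only [descProd_succ, descProd_zero, ascProd_succ, ascProd_zero, one_mul, mul_one]
    rw [hu.factor_mul_factor]
    ring_nf
  | succ l ih =>
    have hc : (1 + y • u m) * descProd u (fun _ => x) (m + 2) l =
        descProd u (fun _ => x) (m + 2) l * (1 + y • u m) :=
      (Commute.one_left _).add_left ((hu.commute_descProd le_rfl _ l).smul_left y)
    have hc' : (1 + x • u m) * ascProd u y (m + 2) l = ascProd u y (m + 2) l * (1 + x • u m) :=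
      (Commute.one_left _).add_left ((hu.commute_ascProd le_rfl _ l).smul_left x)
    calc ascProd u y m (l + 2) * descProd u (fun _ => x) m (l + 2)
        = (1 + y • u m) * (ascProd u y (m + 1) (l + 1) *
            descProd u (fun _ => x) (m + 1) (l + 1)) * (1 + x • u m) := by
          rw [ascProd_succ, descProd_succ]
          simp only [mul_assoc]
      _ = ((1 + y • u m) * descProd u (fun _ => x) (m + 2) l) *
            (1 + (x + y + x * y) • u (m + 1)) * (ascProd u y (m + 2) l * (1 + x • u m)) := by
          rw [ih]
          simp only [mul_assoc]
      _ = descProd u (fun _ => x) (m + 2) l * ((1 + y • u m) *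
            (1 + (x + y + x * y) • u (m + 1)) * (1 + x • u m)) * ascProd u y (m + 2) l := by
          rw [hc, ← hc']
          simp only [mul_assoc]
      _ = _ := by
          rw [hu.yangBaxter, descProd_succ, ascProd_succ]
          simp only [mul_assoc]

/-- One decreasing product moves to the left through a family of increasing products. Each of
these loses its first letter to the decreasing product, so that the last one, which consists of a
single letter, disappears. -/
theorem IsHeckeFamily.prod_ascProd_mul_descProd (x : R) (y : ℕ → R) (m l r : ℕ) (hr : r ≤ m) :
    ((List.range' m (l + 1)).map fun k => ascProd u (y (k - r)) k (m + l + 1 - k)).reverse.prod *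
        descProd u (fun _ => x) m (l + 1) =
      descProd u (fun j => x + y (j - r) + x * y (j - r)) m (l + 1) *
        ((List.range' (m + 1) l).map fun k =>
          ascProd u (y (k - (r + 1))) k (m + l + 1 - k)).reverse.prod := by
  induction l generalizing m with
  | zero =>
    have := hu.ascProd_mul_descProd x (y (m - r)) m 0
    simpa [descProd_succ] using this
  | succ l ih =>
    have hm : m + (l + 1) + 1 = m + 1 + l + 1 := by omega
    have hc : Commute (1 + (x + y (m - r) + x * y (m - r)) • u m)
        ((List.range' (m + 2) l).map fun k =>
          ascProd u (y (k - (r + 1))) k (m + (l + 1) + 1 - k)).reverse.prod := by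
      refine (Commute.one_left _).add_left (Commute.smul_left ?_ _)
      refine Commute.list_prod_right _ _ fun a ha => ?_
      simp only [List.mem_reverse, List.mem_map, List.mem_range'_1] at ha
      obtain ⟨j, hj, rfl⟩ := ha
      exact hu.commute_ascProd (by omega) _ _
    have ih' := ih (m + 1) (by omega)
    rw [← hm] at ih'
    rw [List.range'_succ, List.map_cons, List.reverse_cons, List.prod_append, List.prod_singleton,
      mul_assoc, show m + (l + 1) + 1 - m = l + 1 + 1 by omega, hu.ascProd_mul_descProd,
      ← mul_assoc, ← mul_assoc, ih', mul_assoc (descProd _ _ _ _) _ (1 + _), ← hc.eq,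
      ← mul_assoc (descProd _ _ _ _), ← descProd_succ u
        (fun j => x + y (j - r) + x * y (j - r)) m (l + 1), mul_assoc]
    congr 1
    rw [List.range'_succ (s := m + 1), List.map_cons, List.reverse_cons, List.prod_append,
      List.prod_singleton, show m + 1 - (r + 1) = m - r by omega,
      show m + (l + 1) + 1 - (m + 1) = l + 1 by omega]

/-- The Cauchy identity for the rows `k = m, …, m+l-1`, with the parameters `y` counted from the
first letter of each row. -/
theorem IsHeckeFamily.prod_ascProd_mul_prod_descProd (x y : ℕ → R) (m l : ℕ) :
    ((List.range' m l).map fun k => ascProd u (y (k - m)) k (m + l - k)).reverse.prod *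
        ((List.range' m l).map fun k => descProd u (fun _ => x k) k (m + l - k)).prod =
      ((List.range' m l).map fun k =>
        descProd u (fun j => x k + y (j - k) + x k * y (j - k)) k (m + l - k)).prod := by
  induction l generalizing m with
  | zero => simp
  | succ l ih =>
    have hm : m + 1 + l = m + (l + 1) := by omega
    have ih' := ih (m + 1)
    rw [hm] at ih'
    rw [List.range'_succ, List.map_cons (f := fun k => descProd u (fun _ => x k) k _),
      List.map_cons (f := fun k => descProd u (fun j => _) k _), List.prod_cons, List.prod_cons,
      ← mul_assoc, ← ih', ← mul_assoc, ← List.range'_succ, show m + (l + 1) - m = l + 1 by omega]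
    congr 1
    exact hu.prod_ascProd_mul_descProd (x m) y m l m le_rfl

end HeckeFamily

section Rows

variable {R A : Type*} [CommRing R] [Ring A] [Algebra R A]

/-- The product of the decreasing rows `(1 + z_{k,n-1} u_{n-1}) ⋯ (1 + z_{k,k} u_k)` for
`k = 0, …, n`; the last row is empty. -/
def rowProd (u : ℕ → A) (n : ℕ) (z : ℕ → ℕ → R) : A :=
  ((List.range (n + 1)).map fun k => descProd u (z k) k (n - k)).prod

/-- The product of the increasing rows `(1 + y_k u_k) ⋯ (1 + y_k u_{n-1})` for `k = n, …, 0`. -/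
def ascRowProd (u : ℕ → A) (n : ℕ) (y : ℕ → R) : A :=
  ((List.range (n + 1)).map fun k => ascProd u (y k) k (n - k)).reverse.prod

/-- The Cauchy identity: the double product splits into a product in the `y_k` and one in
the `x_k`. -/
theorem IsHeckeFamily.ascRowProd_mul_rowProd {u : ℕ → A} (hu : IsHeckeFamily u) (n : ℕ)
    (x y : ℕ → R) :
    ascRowProd u n y * rowProd u n (fun k _ => x k) =
      rowProd u n fun k j => x k + y (j - k) + x k * y (j - k) := by
  have := hu.prod_ascProd_mul_prod_descProd x y 0 n
  simpa [ascRowProd, rowProd, List.range_succ, List.range_eq_range'] using this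

/-- Exchanging the variables `x_i` and `x_{i+1}` in the product of the decreasing rows; up to the
division by `x_i - x_{i+1}` this computes the isobaric divided difference. -/
theorem IsHeckeFamily.rowProd_swap {u : ℕ → A} (hu : IsHeckeFamily u) {n i : ℕ} (h : i < n)
    (x x' : ℕ → R) (h1 : x' i = x (i + 1)) (h2 : x' (i + 1) = x i)
    (h3 : ∀ k, k ≠ i → k ≠ i + 1 → x' k = x k) :
    (1 + x (i + 1)) • rowProd u n (fun k _ => x k) - (1 + x i) • rowProd u n (fun k _ => x' k) =
      (x i - x (i + 1)) • (rowProd u n (fun k _ => x k) * (u i - 1)) := by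
  obtain ⟨l, hl⟩ : ∃ l, n - i = l + 1 := ⟨n - i - 1, by omega⟩
  have hsplit : ∀ x : ℕ → R, rowProd u n (fun k _ => x k) =
      ((List.range i).map fun k => descProd u (fun _ => x k) k (n - k)).prod *
        (descProd u (fun _ => x i) i (l + 1) * descProd u (fun _ => x (i + 1)) (i + 1) l) *
        ((List.range' (i + 2) (n - 1 - i)).map fun k =>
          descProd u (fun _ => x k) k (n - k)).prod := by
    intro x
    rw [rowProd, range_succ_eq_append h, List.map_append, List.prod_append, List.map_cons,
      List.map_cons, List.prod_cons, List.prod_cons, hl, show n - (i + 1) = l by omega]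
    simp only [mul_assoc]
  have hpre : (List.range i).map (fun k => descProd u (fun _ => x' k) k (n - k)) =
      (List.range i).map fun k => descProd u (fun _ => x k) k (n - k) := by
    refine List.map_congr_left fun k hk => ?_
    rw [List.mem_range] at hk
    rw [h3 k (by omega) (by omega)]
  have hpost : (List.range' (i + 2) (n - 1 - i)).map
        (fun k => descProd u (fun _ => x' k) k (n - k)) =
      (List.range' (i + 2) (n - 1 - i)).map fun k => descProd u (fun _ => x k) k (n - k) := by
    refine List.map_congr_left fun k hk => ?_
    rw [List.mem_range'_1] at hk
    rw [h3 k (by omega) (by omega)]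
  have hc : Commute (u i - 1) ((List.range' (i + 2) (n - 1 - i)).map
      fun k => descProd u (fun _ => x k) k (n - k)).prod := by
    refine Commute.sub_left (Commute.list_prod_right _ _ fun a ha => ?_) (Commute.one_left _)
    simp only [List.mem_map, List.mem_range'_1] at ha
    obtain ⟨j, hj, rfl⟩ := ha
    exact hu.commute_descProd (by omega) _ _
  rw [hsplit, hsplit, hpre, hpost, h1, h2]
  set P := ((List.range i).map fun k => descProd u (fun _ => x k) k (n - k)).prod
  set Q := ((List.range' (i + 2) (n - 1 - i)).map
    fun k => descProd u (fun _ => x k) k (n - k)).prod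
  have key := (hu.sub_eq_of_mul_factor_eq (i := i) (p := x i) (q := x (i + 1))
    (T := descProd u (fun _ => x i) i (l + 1) * descProd u (fun _ => x (i + 1)) (i + 1) l)
    (T' := descProd u (fun _ => x (i + 1)) i (l + 1) * descProd u (fun _ => x i) (i + 1) l)
    (by
      have := hu.descProd_mul_comm (x i) (x (i + 1)) i (l + 1)
      rw [descProd_succ u (fun _ => x i), descProd_succ u (fun _ => x (i + 1))] at this ⊢
      simpa only [mul_assoc] using this)).1
  set T := descProd u (fun _ => x i) i (l + 1) * descProd u (fun _ => x (i + 1)) (i + 1) l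
  set T' := descProd u (fun _ => x (i + 1)) i (l + 1) * descProd u (fun _ => x i) (i + 1) l
  have e : (x i - x (i + 1)) • (P * T * Q * (u i - 1)) =
      P * ((x i - x (i + 1)) • (T * (u i - 1))) * Q := by
    rw [mul_assoc (P * T), ← hc.eq]
    simp only [mul_assoc, smul_mul_assoc, mul_smul_comm]
  rw [e, ← key]
  simp only [sub_mul, mul_sub, smul_mul_assoc, mul_smul_comm]

end Rows

/-! ### The 0-Hecke algebra and its top coefficient -/

namespace HeckeMonoid

variable {n : ℕ}

/-- The generators of the 0-Hecke monoid as a sequence indexed by the natural numbers, continued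
by `1`. -/
noncomputable def genNat (n j : ℕ) : HeckeMonoid n := if h : j < n then gen ⟨j, h⟩ else 1

theorem genNat_val (i : Fin n) : genNat n i = gen i := dif_pos i.2

theorem isHeckeFamily_genNat (n : ℕ) : IsHeckeFamily (genNat n) where
  mul_self i := by
    unfold genNat
    split_ifs
    · exact gen_mul_self _
    · exact one_mul 1
  braid i := by
    unfold genNat
    split_ifs
    · exact gen_braid rfl
    · rw [mul_one, gen_mul_self, one_mul, mul_one]
    · omega
    · rfl
  comm i j h := by
    unfold genNat
    split_ifs
    · exact gen_mul_gen_comm h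
    all_goals simp

theorem of_inv_one : of (perm (1 : HeckeMonoid n))⁻¹ = 1 :=
  inv_one (G := Perm (Fin (n + 1)))

theorem invCount_genNat_mul_le (j : ℕ) (w : HeckeMonoid n) :
    invCount (genNat n j * w).perm ≤ invCount w.perm + 1 := by
  unfold genNat
  split_ifs with h
  · rw [gen_mul]
    exact invCount_heckeAct_le _ _
  · rw [one_mul]
    exact Nat.le_succ _

end HeckeMonoid

open HeckeMonoid

section Coefficients

variable {n : ℕ} {R : Type*} [CommRing R]

/-- The generators of the 0-Hecke algebra, the monoid algebra of the 0-Hecke monoid. -/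
noncomputable def heckeGen (R : Type*) [CommRing R] (n j : ℕ) : MonoidAlgebra R (HeckeMonoid n) :=
  MonoidAlgebra.of R (HeckeMonoid n) (genNat n j)

theorem isHeckeFamily_heckeGen (R : Type*) [CommRing R] (n : ℕ) : IsHeckeFamily (heckeGen R n) :=
  (isHeckeFamily_genNat n).map (MonoidAlgebra.of R (HeckeMonoid n))

theorem coeff_mul_eq_sum (a b : MonoidAlgebra R (HeckeMonoid n)) (w : HeckeMonoid n) :
    (a * b).coeff w = ∑ p : HeckeMonoid n × HeckeMonoid n with p.1 * p.2 = w,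
      a.coeff p.1 * b.coeff p.2 :=
  MonoidAlgebra.coeff_mul_antidiag a b w _ (by simp)

theorem coeff_of_mul (a : MonoidAlgebra R (HeckeMonoid n)) (g w : HeckeMonoid n) :
    (MonoidAlgebra.of R _ g * a).coeff w = ∑ v with g * v = w, a.coeff v := by
  induction a using MonoidAlgebra.induction_linear with
  | zero => simp
  | add a b ha hb => simp only [mul_add, MonoidAlgebra.coeff_add, Finsupp.add_apply, ha, hb,
      Finset.sum_add_distrib]
  | single v r =>
    simp [MonoidAlgebra.single_mul_single, Finsupp.single_apply]

theorem coeff_mul_of (a : MonoidAlgebra R (HeckeMonoid n)) (g w : HeckeMonoid n) :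
    (a * MonoidAlgebra.of R _ g).coeff w = ∑ v with v * g = w, a.coeff v := by
  induction a using MonoidAlgebra.induction_linear with
  | zero => simp
  | add a b ha hb => simp only [add_mul, MonoidAlgebra.coeff_add, Finsupp.add_apply, ha, hb,
      Finset.sum_add_distrib]
  | single v r =>
    simp [MonoidAlgebra.single_mul_single, Finsupp.single_apply]

/-- A product of `ℓ` factors `1 + z u_j` contributes to a permutation with at least `ℓ` inversions
only through the product of all the `z u_j`. -/
theorem coeff_prod_factor (L : List (ℕ × R)) (w : HeckeMonoid n)
    (hw : L.length ≤ invCount w.perm) :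
    (L.map fun c : ℕ × R => 1 + c.2 • heckeGen R n c.1).prod.coeff w =
      if (L.map fun c => genNat n c.1).prod = w then (L.map Prod.snd).prod else 0 := by
  have hlen : ∀ L : List (ℕ × R),
      invCount (L.map fun c => genNat n c.1).prod.perm ≤ L.length := by
    intro L
    induction L with
    | nil => exact invCount_one.le
    | cons c L ih =>
      have := invCount_genNat_mul_le c.1 (L.map fun c => genNat n c.1).prod
      simp only [List.map_cons, List.prod_cons, List.length_cons]
      omega
  induction L generalizing w with
  | nil => simp [MonoidAlgebra.one_def, Finsupp.single_apply]
  | cons c L ih =>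
    rw [List.length_cons] at hw
    simp only [List.map_cons, List.prod_cons, add_mul, one_mul, smul_mul_assoc,
      MonoidAlgebra.coeff_add, MonoidAlgebra.coeff_smul, Finsupp.add_apply, Finsupp.smul_apply]
    have hne : (L.map fun c => genNat n c.1).prod ≠ w := by
      rintro rfl
      have := hlen L
      omega
    rw [ih w (by omega), if_neg hne, heckeGen, coeff_of_mul, zero_add, smul_eq_mul]
    have hsum : ∀ v ∈ Finset.univ.filter (fun v => genNat n c.1 * v = w),
        (L.map fun c : ℕ × R => 1 + c.2 • heckeGen R n c.1).prod.coeff v =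
          if (L.map fun c => genNat n c.1).prod = v then (L.map Prod.snd).prod else 0 := by
      intro v hv
      refine ih v ?_
      rw [Finset.mem_filter] at hv
      have := invCount_genNat_mul_le c.1 v
      rw [hv.2] at this
      omega
    rw [Finset.sum_congr rfl hsum, Finset.sum_ite_eq]
    simp

theorem List.prod_map_flatMap {α β M : Type*} [Monoid M] (l : List α) (f : α → List β)
    (g : β → M) : ((l.flatMap f).map g).prod = (l.map fun a => ((f a).map g).prod).prod := by
  induction l with
  | nil => rfl
  | cons a l ih => rw [List.flatMap_cons, List.map_append, List.prod_append, ih]; rfl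

theorem invCount_longestPerm (n : ℕ) :
    invCount (longestPerm n) = ∑ k ∈ Finset.range (n + 1), (n - k) := by
  have h : (Finset.univ.filter fun p : Fin (n + 1) × Fin (n + 1) =>
      p.1 < p.2 ∧ longestPerm n p.2 < longestPerm n p.1) =
      Finset.univ.filter fun p : Fin (n + 1) × Fin (n + 1) => p.1 < p.2 := by
    refine Finset.filter_congr fun p _ => ?_
    simp [longestPerm]
  rw [invCount, h, Finset.card_filter, Fintype.sum_prod_type, Finset.sum_range]
  refine Finset.sum_congr rfl fun k _ => ?_
  rw [← Finset.card_filter, Finset.filter_lt_eq_Ioi, Fin.card_Ioi]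
  omega

/-- The coefficient of the longest permutation in a product of decreasing rows. -/
theorem coeff_rowProd_longestPerm (n : ℕ) (z : ℕ → ℕ → R) :
    (rowProd (heckeGen R n) n z).coeff (of (longestPerm n)) =
      ∏ k ∈ Finset.range (n + 1), ∏ j ∈ Finset.range (n - k), z k (k + j) := by
  set L : List (ℕ × R) := (List.range (n + 1)).flatMap fun k =>
    (List.range' k (n - k)).reverse.map fun j => (j, z k j)
  have hprod : rowProd (heckeGen R n) n z =
      (L.map fun c => 1 + c.2 • heckeGen R n c.1).prod := by
    simp only [L, rowProd, descProd, List.prod_map_flatMap, List.map_reverse, List.map_map]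
    rfl
  have hlen : L.length = invCount (longestPerm n) := by
    rw [invCount_longestPerm, List.length_flatMap]
    simp only [List.length_map, List.length_reverse, List.length_range']
    rfl
  have hgen : (L.map fun c => genNat n c.1).prod = of (longestPerm n) := by
    have e : (L.map fun c => genNat n c.1).prod =
        ((List.range (n + 1)).map fun k => descWord (genNat n) k (n - k)).prod := by
      simp only [L, descWord, List.prod_map_flatMap, List.map_reverse, List.map_map]
      rfl
    rw [e]
    refine eq_longestPerm fun i => ?_
    rw [← genNat_val]
    exact (isHeckeFamily_genNat n).prod_descWord_mul i.2
  rw [hprod, coeff_prod_factor L (of (longestPerm n)) hlen.le, if_pos hgen]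
  have hrow : ∀ k, (List.map Prod.snd ((List.range' k (n - k)).reverse.map
      fun j => (j, z k j))).prod = ∏ j ∈ Finset.range (n - k), z k (k + j) := by
    intro k
    rw [List.map_reverse, List.map_reverse, List.prod_reverse, List.map_map,
      List.range'_eq_map_range, List.map_map]
    rfl
  simp only [L, List.prod_map_flatMap, hrow]
  rfl

theorem mapRingHom_rowProd {S : Type*} [CommRing S] (f : R →+* S) (z : ℕ → ℕ → R) :
    MonoidAlgebra.mapRingHom (HeckeMonoid n) f (rowProd (heckeGen R n) n z) =
      rowProd (heckeGen S n) n fun k j => f (z k j) := by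
  simp only [rowProd, descProd, map_list_prod, List.map_map]
  congr 2
  funext k
  simp only [Function.comp_apply, map_list_prod, List.map_map, List.map_reverse]
  congr 3
  funext j
  simp [heckeGen]

theorem mapRingHom_ascRowProd {S : Type*} [CommRing S] (f : R →+* S) (y : ℕ → R) :
    MonoidAlgebra.mapRingHom (HeckeMonoid n) f (ascRowProd (heckeGen R n) n y) =
      ascRowProd (heckeGen S n) n fun k => f (y k) := by
  simp only [ascRowProd, ascProd, map_list_prod, List.map_map, List.map_reverse]
  congr 3
  funext k
  simp only [Function.comp_apply, map_list_prod, List.map_map]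
  congr 2
  funext j
  simp [heckeGen]

/-- The anti-automorphism of the 0-Hecke algebra that inverts permutations. -/
noncomputable def heckeAnti (R : Type*) [CommRing R] (n : ℕ) :
    MonoidAlgebra R (HeckeMonoid n) →ₐ[R] (MonoidAlgebra R (HeckeMonoid n))ᵐᵒᵖ :=
  MonoidAlgebra.lift R _ _
    { toFun := fun w => MulOpposite.op (MonoidAlgebra.of R _ (of w.perm⁻¹))
      map_one' := by
        rw [of_inv_one, map_one, MulOpposite.op_one]
      map_mul' := fun u v => by
        rw [of_inv_mul, map_mul, MulOpposite.op_mul] }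

theorem coeff_unop_heckeAnti (a : MonoidAlgebra R (HeckeMonoid n)) (w : HeckeMonoid n) :
    (heckeAnti R n a).unop.coeff w = a.coeff (of w.perm⁻¹) := by
  induction a using MonoidAlgebra.induction_linear with
  | zero => simp
  | add a b ha hb => simp [ha, hb]
  | single v r =>
    have : of v.perm⁻¹ = w ↔ v = of w.perm⁻¹ := inv_eq_iff_eq_inv (a := v.perm) (b := w.perm)
    simp [heckeAnti, Finsupp.single_apply, this]

theorem heckeAnti_heckeGen (j : ℕ) :
    heckeAnti R n (heckeGen R n j) = MulOpposite.op (heckeGen R n j) := by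
  have : of (genNat n j).perm⁻¹ = genNat n j := by
    unfold genNat
    split_ifs
    · rw [gen_eq, perm_of, adjSwap_inv]
    · exact of_inv_one
  simp [heckeAnti, heckeGen, this]

theorem unop_heckeAnti_rowProd (y : ℕ → R) :
    (heckeAnti R n (rowProd (heckeGen R n) n fun k _ => y k)).unop =
      ascRowProd (heckeGen R n) n y := by
  have h : ∀ (z : R) (m l : ℕ), (heckeAnti R n (descProd (heckeGen R n) (fun _ => z) m l)).unop =
      ascProd (heckeGen R n) z m l := by
    intro z m l
    induction l generalizing m with
    | zero => simp
    | succ l ih =>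
      rw [descProd_succ, ascProd_succ, map_mul, MulOpposite.unop_mul, ih]
      simp [heckeAnti_heckeGen]
  simp only [rowProd, ascRowProd, map_list_prod, MulOpposite.unop_list_prod, List.map_map]
  congr 3
  funext k
  exact h _ _ _

theorem coeff_ascRowProd (y : ℕ → R) (w : HeckeMonoid n) :
    (ascRowProd (heckeGen R n) n y).coeff w =
      (rowProd (heckeGen R n) n fun k _ => y k).coeff (of w.perm⁻¹) := by
  rw [← unop_heckeAnti_rowProd, coeff_unop_heckeAnti]

end Coefficients

/-! ### Isobaric divided differences of coefficients -/

section DividedDifferences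

open MvPolynomial

variable {σ : Type} [DecidableEq σ] {n : ℕ}

/-- Characterization of the isobaric divided difference without division. -/
theorem piOp_eq_of {x : Fin (n + 1) → σ} (hx : Function.Injective x) (i : Fin n)
    {f g : MvPolynomial σ ℤ}
    (h : (1 + X (x i.succ)) * f -
        (1 + X (x i.castSucc)) * rename (swap (x i.castSucc) (x i.succ)) f =
      (X (x i.castSucc) - X (x i.succ)) * g) : piOp x i f = g := by
  have hne : (X (x i.castSucc) - X (x i.succ) : MvPolynomial σ ℤ) ≠ 0 := by
    rw [sub_ne_zero]
    exact fun h => (Fin.castSucc_lt_succ (i := i)).ne (hx (X_injective h))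
  refine mul_left_cancel₀ hne ?_
  rw [← h, piOp, mul_add, ← divDiff_spec, ← divDiff_spec, map_mul, rename_X, swap_apply_right]
  ring

/-- The variables as a sequence indexed by the natural numbers, continued by `0`. -/
noncomputable def varSeq (x : Fin (n + 1) → σ) (k : ℕ) : MvPolynomial σ ℤ :=
  if h : k < n + 1 then X (x ⟨k, h⟩) else 0

omit [DecidableEq σ] in
theorem varSeq_val (x : Fin (n + 1) → σ) (k : Fin (n + 1)) : varSeq x k = X (x k) := dif_pos k.2

/-- If `w s_i` has fewer inversions than `w`, then exactly `w` and `w s_i` have the product `w`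
with `u_i`, and the contribution of `w` cancels. -/
theorem coeff_mul_gen_of_lt {R : Type*} [CommRing R] (a : MonoidAlgebra R (HeckeMonoid n))
    (i : Fin n) (w : Perm (Fin (n + 1))) (h : w i.succ < w i.castSucc) :
    (a * (heckeGen R n i - 1)).coeff (of w) = a.coeff (of (w * adjSwap i)) := by
  have hne : of w ≠ of (w * adjSwap i) := by
    intro h'
    have := congrArg (fun v => perm v i.castSucc) h'
    simp only [perm_of, Perm.mul_apply, adjSwap_castSucc] at this
    exact h.ne' this
  have hset : (Finset.univ.filter fun v : HeckeMonoid n => v * gen i = of w) =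
      {of w, of (w * adjSwap i)} := by
    ext v
    simp only [Finset.mem_filter, Finset.mem_univ, true_and, Finset.mem_insert,
      Finset.mem_singleton, mul_gen]
    constructor
    · intro hv
      change heckeActRight i v.perm = w at hv
      unfold heckeActRight at hv
      split_ifs at hv with h1
      · right
        rw [← hv, mul_assoc, adjSwap_mul_self, mul_one, of_perm]
      · left
        rw [← hv, of_perm]
    · rintro (hv | rfl)
      · rw [hv, perm_of, heckeActRight, if_neg h.not_gt]
      · rw [perm_of, heckeActRight, if_pos (by simpa using h), mul_assoc, adjSwap_mul_self, mul_one]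
  rw [mul_sub, mul_one, heckeGen, genNat_val, MonoidAlgebra.coeff_sub, Finsupp.sub_apply,
    coeff_mul_of, hset, Finset.sum_pair hne, add_sub_cancel_left]

/-- The coefficients of `P ∏ A_k(x_k)` are permuted by the isobaric divided differences, if the
coefficients of `P` are symmetric in the `x_k`. -/
theorem piOp_coeff {x : Fin (n + 1) → σ} (hx : Function.Injective x)
    {P : MonoidAlgebra (MvPolynomial σ ℤ) (HeckeMonoid n)} (i : Fin n)
    (hP : MonoidAlgebra.mapRingHom (HeckeMonoid n)
      (rename (swap (x i.castSucc) (x i.succ)) :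
        MvPolynomial σ ℤ →ₐ[ℤ] MvPolynomial σ ℤ).toRingHom P = P)
    (w : Perm (Fin (n + 1))) (h : w i.succ < w i.castSucc) :
    piOp x i ((P * rowProd (heckeGen _ n) n fun k _ => varSeq x k).coeff (of w)) =
      (P * rowProd (heckeGen _ n) n fun k _ => varSeq x k).coeff (of (w * adjSwap i)) := by
  set φ := (rename (swap (x i.castSucc) (x i.succ)) :
    MvPolynomial σ ℤ →ₐ[ℤ] MvPolynomial σ ℤ).toRingHom with hφ
  have hi : varSeq x i = X (x i.castSucc) := varSeq_val x i.castSucc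
  have hi' : varSeq x (i + 1) = X (x i.succ) := varSeq_val x i.succ
  have key := (isHeckeFamily_heckeGen (MvPolynomial σ ℤ) n).rowProd_swap i.2 (varSeq x)
    (fun k => φ (varSeq x k)) (by rw [hi, hi']; simp [φ]) (by rw [hi, hi']; simp [φ]) (by
      intro k h1 h2
      unfold varSeq
      split_ifs with h
      · simp only [φ, AlgHom.toRingHom_eq_coe, RingHom.coe_coe, rename_X]
        rw [swap_apply_of_ne_of_ne]
        · exact fun h' => h1 (congrArg Fin.val (hx h'))
        · exact fun h' => h2 (congrArg Fin.val (hx h'))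
      · simp)
  rw [← mapRingHom_rowProd φ (n := n) (fun k _ => varSeq x k), hi, hi'] at key
  refine piOp_eq_of hx i ?_
  set E := rowProd (heckeGen (MvPolynomial σ ℤ) n) n fun k _ => varSeq x k
  have hE : P * MonoidAlgebra.mapRingHom (HeckeMonoid n) φ E =
      MonoidAlgebra.mapRingHom (HeckeMonoid n) φ (P * E) := by rw [map_mul, hP]
  have key2 := congrArg (fun a => (P * a).coeff (of w)) key
  simp only [mul_sub P, mul_smul_comm] at key2
  rw [hE, ← mul_assoc] at key2
  simp only [MonoidAlgebra.coeff_sub, MonoidAlgebra.coeff_smul, Finsupp.sub_apply,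
    Finsupp.smul_apply, smul_eq_mul] at key2
  rw [coeff_mul_gen_of_lt _ _ _ h] at key2
  rw [← key2, MonoidAlgebra.coeff_mapRingHom]
  rfl

theorem piWord_coeff {x : Fin (n + 1) → σ} (hx : Function.Injective x)
    {P : MonoidAlgebra (MvPolynomial σ ℤ) (HeckeMonoid n)}
    (hP : ∀ i : Fin n, MonoidAlgebra.mapRingHom (HeckeMonoid n)
      (rename (swap (x i.castSucc) (x i.succ)) :
        MvPolynomial σ ℤ →ₐ[ℤ] MvPolynomial σ ℤ).toRingHom P = P)
    {a : List (Fin n)} {v : Perm (Fin (n + 1))} (ha : IsReducedWord a v) :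
    piWord x a ((P * rowProd (heckeGen _ n) n fun k _ => varSeq x k).coeff (of (longestPerm n))) =
      (P * rowProd (heckeGen _ n) n fun k _ => varSeq x k).coeff (of (longestPerm n * v⁻¹)) := by
  induction a generalizing v with
  | nil =>
    obtain rfl : 1 = v := ha.1
    rw [inv_one, mul_one]
    rfl
  | cons i a ih =>
    obtain ⟨h1, rfl, h3⟩ := ha.of_cons
    have := ih h1
    unfold piWord at this ⊢
    rw [List.foldr_cons, this, piOp_coeff hx i (hP i), mul_inv_rev, adjSwap_inv, mul_assoc]
    simpa [longestPerm] using h3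

theorem piPerm_coeff {x : Fin (n + 1) → σ} (hx : Function.Injective x)
    {P : MonoidAlgebra (MvPolynomial σ ℤ) (HeckeMonoid n)}
    (hP : ∀ i : Fin n, MonoidAlgebra.mapRingHom (HeckeMonoid n)
      (rename (swap (x i.castSucc) (x i.succ)) :
        MvPolynomial σ ℤ →ₐ[ℤ] MvPolynomial σ ℤ).toRingHom P = P)
    (w : Perm (Fin (n + 1))) :
    piPerm x (w⁻¹ * longestPerm n)
        ((P * rowProd (heckeGen _ n) n fun k _ => varSeq x k).coeff (of (longestPerm n))) =
      (P * rowProd (heckeGen _ n) n fun k _ => varSeq x k).coeff (of w) := by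
  rw [piPerm, piWord_coeff hx hP (Classical.choose_spec (exists_isReducedWord _))]
  congr 2
  group

theorem grothendieck_eq_coeff (w : Perm (Fin (n + 1))) :
    grothendieck w =
      (rowProd (heckeGen _ n) n fun k _ => varSeq (fun i : Fin (n + 1) => i) k).coeff (of w) := by
  have h := piPerm_coeff (x := fun i : Fin (n + 1) => i) Function.injective_id (P := 1)
    (fun i => map_one _) w
  rw [one_mul, coeff_rowProd_longestPerm] at h
  rw [grothendieck, ← h]
  congr 1
  simp only [Finset.prod_const, Finset.card_range]
  rw [Finset.prod_range]
  simp only [varSeq_val]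

/-- The variables `x_k` of `XYPoly n` as a sequence. -/
noncomputable abbrev xSeq (n : ℕ) : ℕ → XYPoly n :=
  varSeq (Sum.inl : Fin (n + 1) → Fin (n + 1) ⊕ Fin (n + 1))

/-- The variables `y_k` of `XYPoly n` as a sequence. -/
noncomputable abbrev ySeq (n : ℕ) : ℕ → XYPoly n :=
  varSeq (Sum.inr : Fin (n + 1) → Fin (n + 1) ⊕ Fin (n + 1))

theorem doubleGrothendieck_eq_coeff (w : Perm (Fin (n + 1))) :
    doubleGrothendieck w =
      (ascRowProd (heckeGen (XYPoly n) n) n (ySeq n) *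
        rowProd (heckeGen (XYPoly n) n) n fun k _ => xSeq n k).coeff (of w) := by
  have h := piPerm_coeff (x := (Sum.inl : Fin (n + 1) → Fin (n + 1) ⊕ Fin (n + 1)))
    Sum.inl_injective
    (P := ascRowProd (heckeGen (XYPoly n) n) n (ySeq n)) (fun i => by
      rw [mapRingHom_ascRowProd]
      refine congrArg (ascRowProd _ n) (funext fun k => ?_)
      unfold ySeq varSeq
      split_ifs
      · simp only [AlgHom.toRingHom_eq_coe, RingHom.coe_coe, rename_X]
        rw [swap_apply_of_ne_of_ne Sum.inr_ne_inl Sum.inr_ne_inl]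
      · simp) w
  rw [doubleGrothendieck, ← h, (isHeckeFamily_heckeGen _ n).ascRowProd_mul_rowProd,
    coeff_rowProd_longestPerm]
  congr 1
  rw [Finset.prod_filter, Fintype.prod_prod_type, Finset.prod_range]
  refine Finset.prod_congr rfl fun k _ => ?_
  have hset : (Finset.range (n + 1)).filter (fun j => (k : ℕ) + j + 2 ≤ n + 1) =
      Finset.range (n - k) := by
    ext j
    simp only [Finset.mem_filter, Finset.mem_range]
    omega
  rw [← hset, Finset.prod_filter, Finset.prod_range]
  refine Finset.prod_congr rfl fun j _ => ?_
  rw [Nat.add_sub_cancel_left, varSeq_val,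
    show ySeq n j = X (Sum.inr j) from varSeq_val _ j]
  rfl

end DividedDifferences

/-! ### Expanding products over factorizations -/

section Expansion

open HeckeMonoid

theorem List.prod_map_one_add_eq_sum {α A : Type*} [DecidableEq α] [Ring A] (t : α → A)
    {L : List α} (hL : L.Nodup) :
    (L.map fun c => 1 + t c).prod = ∑ l ∈ L.sublists'.toFinset, (l.map t).prod := by
  rw [List.sum_toFinset _ (List.nodup_sublists'.mpr hL)]
  clear hL
  induction L with
  | nil => simp
  | cons a L ih =>
    rw [List.map_cons, List.prod_cons, ih, List.sublists'_cons, List.map_append, List.sum_append,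
      add_mul, one_mul, ← List.sum_map_mul_left, List.map_map]
    congr 2

/-- For a list sorted by a strict order, its sublists are the sorted lists of its elements. -/
theorem List.sublist_iff_pairwise_and_forall_mem {α : Type*} {r : α → α → Prop} [Std.Antisymm r]
    [Std.Irrefl r] {L : List α} (hL : L.Pairwise r) (l : List α) :
    l.Sublist L ↔ l.Pairwise r ∧ ∀ c ∈ l, c ∈ L :=
  ⟨fun h => ⟨hL.sublist h, fun _ hc => h.subset hc⟩, fun h =>
    List.sublist_of_subperm_of_pairwise (List.subperm_of_subset h.1.nodup h.2) h.1 hL⟩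

/-- Distributivity for a product of sums in a noncommutative ring. -/
theorem List.prod_ofFn_sum {A β : Type*} [Ring A] {m : ℕ} (S : Fin m → Finset β)
    (g : Fin m → β → A) :
    (List.ofFn fun k => ∑ l ∈ S k, g k l).prod =
      ∑ f ∈ Fintype.piFinset S, (List.ofFn fun k => g k (f k)).prod := by
  have := (MultilinearMap.mkPiAlgebraFin ℤ m A).map_sum_finset g S
  simpa only [MultilinearMap.mkPiAlgebraFin_apply] using this

theorem List.prod_reverse_ofFn_sum {A β : Type*} [Ring A] {m : ℕ} (S : Fin m → Finset β)
    (g : Fin m → β → A) :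
    (List.ofFn fun k => ∑ l ∈ S k, g k l).reverse.prod =
      ∑ f ∈ Fintype.piFinset S, (List.ofFn fun k => g k (f k)).reverse.prod := by
  have h : ∀ a : Fin m → A,
      (List.ofFn a).reverse.prod = (List.ofFn fun k => MulOpposite.op (a k)).prod.unop := by
    intro a
    rw [MulOpposite.unop_list_prod, List.map_ofFn]
    rfl
  simp only [h, Finset.op_sum]
  rw [List.prod_ofFn_sum S fun k l => MulOpposite.op (g k l), Finset.unop_sum]

variable {n : ℕ} {R : Type*} [CommRing R]

theorem prod_map_smul_of {α : Type*} (c : α → R) (a : α → List (Fin n)) (L : List α) :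
    (L.map fun k => c k • MonoidAlgebra.of R (HeckeMonoid n) (eval (a k))).prod =
      (L.map c).prod • MonoidAlgebra.of R (HeckeMonoid n) (eval (L.map a).flatten) := by
  induction L with
  | nil => simp [eval_nil, MonoidAlgebra.one_def]
  | cons k L ih =>
    rw [List.map_cons, List.prod_cons, ih, List.map_cons, List.map_cons, List.prod_cons,
      List.flatten_cons, eval_append, map_mul, smul_mul_smul_comm]

theorem prod_map_smul_heckeGen {α : Type*} (c : α → R) (ν : α → Fin n) (L : List α) :
    (L.map fun k => c k • heckeGen R n (ν k)).prod =
      (L.map c).prod • MonoidAlgebra.of R (HeckeMonoid n) (eval (L.map ν)) := by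
  have h := prod_map_smul_of c (fun k => [ν k]) L
  have e : (L.map fun k => [ν k]).flatten = L.map ν := by
    induction L with
    | nil => rfl
    | cons k L ih => simpa using ih (prod_map_smul_of c _ L)
  rw [e] at h
  rw [← h]
  simp only [heckeGen, genNat_val]
  rfl

theorem coeff_sum_smul_of {β : Type*} (S : Finset β) (c : β → R) (a : β → List (Fin n))
    (w : Perm (Fin (n + 1))) [DecidablePred fun f => IsHeckeWord (a f) w] :
    (∑ f ∈ S, c f • MonoidAlgebra.of R (HeckeMonoid n) (eval (a f))).coeff (of w) =
      ∑ f ∈ S with IsHeckeWord (a f) w, c f := by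
  rw [MonoidAlgebra.coeff_sum, Finset.sum_filter, Finsupp.finsetSum_apply]
  refine Finset.sum_congr rfl fun f _ => ?_
  simp [Finsupp.single_apply, isHeckeWord_iff]

/-- The letters `≥ k`, in increasing order. -/
def lettersFrom (n k : ℕ) : List (Fin n) := (List.finRange n).filter fun j => k ≤ (j : ℕ)

theorem mem_lettersFrom {k : ℕ} {j : Fin n} : j ∈ lettersFrom n k ↔ k ≤ (j : ℕ) := by
  simp [lettersFrom]

theorem pairwise_lettersFrom (n k : ℕ) : (lettersFrom n k).Pairwise (· < ·) :=
  (List.pairwise_lt_finRange n).filter _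

theorem map_val_lettersFrom {k : ℕ} (h : k ≤ n) :
    (lettersFrom n k).map Fin.val = List.range' k (n - k) := by
  have h1 := List.range'_append_1 (s := 0) (m := k) (n := n - k)
  rw [Nat.zero_add, Nat.add_sub_cancel' h, ← List.range_eq_range', ← List.range_eq_range'] at h1
  have h2 : (lettersFrom n k).map Fin.val = (List.range n).filter fun j => k ≤ j := by
    rw [← List.map_coe_finRange_eq_range, List.filter_map]
    rfl
  rw [h2, ← h1, List.filter_append, List.filter_eq_nil_iff.mpr, List.filter_eq_self.mpr,
    List.nil_append]
  · intro j hj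
    rw [List.mem_range'_1] at hj
    exact decide_eq_true hj.1
  · intro j hj
    rw [List.mem_range] at hj
    simpa using hj

theorem descProd_eq_prod_lettersFrom {A : Type*} [Ring A] [Algebra R A] (u : ℕ → A) (z : ℕ → R)
    {k : ℕ} (h : k ≤ n) :
    descProd u z k (n - k) =
      ((lettersFrom n k).reverse.map fun j : Fin n => 1 + z j • u j).prod := by
  rw [descProd, ← map_val_lettersFrom h, List.map_map, List.map_reverse]
  rfl

theorem ascProd_eq_prod_lettersFrom {A : Type*} [Ring A] [Algebra R A] (u : ℕ → A) (z : R)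
    {k : ℕ} (h : k ≤ n) :
    ascProd u z k (n - k) = ((lettersFrom n k).map fun j : Fin n => 1 + z • u j).prod := by
  rw [ascProd, ← map_val_lettersFrom h, List.map_map]
  rfl

theorem rowProd_eq_prod_ofFn {A : Type*} [Ring A] [Algebra R A] (u : ℕ → A) (z : ℕ → ℕ → R) :
    rowProd u n z = (List.ofFn fun k : Fin (n + 1) => descProd u (z k) k (n - k)).prod := by
  rw [rowProd, ← List.map_coe_finRange_eq_range, List.map_map, List.ofFn_eq_map]
  rfl

theorem ascRowProd_eq_prod_ofFn {A : Type*} [Ring A] [Algebra R A] (u : ℕ → A) (y : ℕ → R) :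
    ascRowProd u n y =
      (List.ofFn fun k : Fin (n + 1) => ascProd u (y k) k (n - k)).reverse.prod := by
  rw [ascRowProd, ← List.map_coe_finRange_eq_range, List.map_map, List.ofFn_eq_map]
  rfl

/-- The strictly decreasing words with letters `≥ k`. -/
def decreasingWords (n k : ℕ) : Finset (List (Fin n)) :=
  (lettersFrom n k).reverse.sublists'.toFinset

/-- The strictly increasing words with letters `≥ k`. -/
def increasingWords (n k : ℕ) : Finset (List (Fin n)) := (lettersFrom n k).sublists'.toFinset

theorem mem_decreasingWords {k : ℕ} {l : List (Fin n)} :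
    l ∈ decreasingWords n k ↔ l.Pairwise (· > ·) ∧ ∀ c ∈ l, k ≤ (c : ℕ) := by
  rw [decreasingWords, List.mem_toFinset, List.mem_sublists',
    List.sublist_iff_pairwise_and_forall_mem
      (List.pairwise_reverse.mpr (pairwise_lettersFrom n k) :
        (lettersFrom n k).reverse.Pairwise (· > ·))]
  simp [mem_lettersFrom]

theorem mem_increasingWords {k : ℕ} {l : List (Fin n)} :
    l ∈ increasingWords n k ↔ l.Pairwise (· < ·) ∧ ∀ c ∈ l, k ≤ (c : ℕ) := by
  rw [increasingWords, List.mem_toFinset, List.mem_sublists',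
    List.sublist_iff_pairwise_and_forall_mem (pairwise_lettersFrom n k)]
  simp [mem_lettersFrom]

theorem rowProd_eq_sum (x : ℕ → R) :
    rowProd (heckeGen R n) n (fun k _ => x k) =
      ∑ f ∈ Fintype.piFinset fun k : Fin (n + 1) => decreasingWords n k,
        (∏ k : Fin (n + 1), x k ^ (f k).length) •
          MonoidAlgebra.of R (HeckeMonoid n) (eval (List.ofFn f).flatten) := by
  have hrow : ∀ k : Fin (n + 1), descProd (heckeGen R n) (fun _ => x k) k (n - k) =
      ∑ l ∈ decreasingWords n k,
        x k ^ l.length • MonoidAlgebra.of R (HeckeMonoid n) (eval l) := by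
    intro k
    rw [descProd_eq_prod_lettersFrom _ _ (Nat.lt_succ_iff.mp k.2), List.prod_map_one_add_eq_sum
      (fun j : Fin n => x k • heckeGen R n j)
      (List.nodup_reverse.mpr (pairwise_lettersFrom n k).nodup)]
    refine Finset.sum_congr rfl fun l _ => ?_
    rw [prod_map_smul_heckeGen (fun _ => x k) (fun j => j)]
    simp
  rw [rowProd_eq_prod_ofFn]
  simp only [hrow]
  rw [List.prod_ofFn_sum]
  refine Finset.sum_congr rfl fun f _ => ?_
  rw [List.ofFn_eq_map, prod_map_smul_of (fun k : Fin (n + 1) => x k ^ (f k).length) f,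
    ← List.ofFn_eq_map, ← List.ofFn_eq_map, List.prod_ofFn]

theorem ascRowProd_eq_sum (y : ℕ → R) :
    ascRowProd (heckeGen R n) n y =
      ∑ f ∈ Fintype.piFinset fun k : Fin (n + 1) => increasingWords n k,
        (∏ k : Fin (n + 1), y k ^ (f k).length) •
          MonoidAlgebra.of R (HeckeMonoid n) (eval (List.ofFn f).reverse.flatten) := by
  have hrow : ∀ k : Fin (n + 1), ascProd (heckeGen R n) (y k) k (n - k) =
      ∑ l ∈ increasingWords n k,
        y k ^ l.length • MonoidAlgebra.of R (HeckeMonoid n) (eval l) := by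
    intro k
    rw [ascProd_eq_prod_lettersFrom _ _ (Nat.lt_succ_iff.mp k.2), List.prod_map_one_add_eq_sum
      (fun j : Fin n => y k • heckeGen R n j) (pairwise_lettersFrom n k).nodup]
    refine Finset.sum_congr rfl fun l _ => ?_
    rw [prod_map_smul_heckeGen (fun _ => y k) (fun j => j)]
    simp
  rw [ascRowProd_eq_prod_ofFn]
  simp only [hrow]
  rw [List.prod_reverse_ofFn_sum]
  refine Finset.sum_congr rfl fun f _ => ?_
  rw [List.ofFn_eq_map, ← List.map_reverse,
    prod_map_smul_of (fun k : Fin (n + 1) => y k ^ (f k).length) f, List.map_reverse,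
    List.map_reverse, ← List.ofFn_eq_map, ← List.ofFn_eq_map, List.prod_reverse, List.prod_ofFn]

end Expansion

/-! ### Double Hecke factorizations -/

theorem doubleGrothendieck_eq_sum_boundedDouble {n : ℕ} (w : Perm (Fin (n + 1))) :
    doubleGrothendieck w = ∑ f ∈ (boundedDouble_finite w).toFinset,
      xyMonomial (doubleXWeight f) (doubleYWeight f) := by
  classical
  rw [doubleGrothendieck_eq_coeff, rowProd_eq_sum, ascRowProd_eq_sum, Finset.sum_mul_sum,
    ← Finset.sum_product']
  simp only [smul_mul_smul_comm, ← map_mul, ← HeckeMonoid.eval_append]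
  rw [coeff_sum_smul_of]
  refine Finset.sum_congr ?_ fun p _ => ?_
  · ext p
    simp only [Finset.mem_filter, Finset.mem_product, Fintype.mem_piFinset, mem_increasingWords,
      mem_decreasingWords, Set.Finite.mem_toFinset, boundedDouble, Set.mem_ofPred_eq]
    grind
  · rw [mul_comm, xyMonomial]
    simp only [varSeq_val]
    rfl

/-! ### Circled Hecke factorizations -/

section Circled

open HeckeMonoid

variable {n : ℕ}

/-- The circled and uncircled letters of value `≥ k`, in decreasing order. -/
def circledLettersFrom (n k : ℕ) : List (CircledLetter n) :=
  (lettersFrom n k).reverse.flatMap fun j => [(j, false), (j, true)]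

theorem mem_circledLettersFrom {k : ℕ} {c : CircledLetter n} :
    c ∈ circledLettersFrom n k ↔ k ≤ (c.1 : ℕ) := by
  obtain ⟨j, b⟩ := c
  cases b <;> simp [circledLettersFrom, mem_lettersFrom]

instance : Std.Irrefl fun c d : CircledLetter n => circledLT d c :=
  ⟨fun c h => by unfold circledLT at h; grind⟩

instance : Std.Antisymm fun c d : CircledLetter n => circledLT d c :=
  ⟨fun c d h1 h2 => by unfold circledLT at h1 h2; grind⟩

theorem pairwise_circledLettersFrom (n k : ℕ) :
    (circledLettersFrom n k).Pairwise fun c d => circledLT d c := by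
  rw [circledLettersFrom, List.pairwise_flatMap]
  refine ⟨fun j _ => by simp [circledLT], ?_⟩
  refine (List.pairwise_reverse.mpr (pairwise_lettersFrom n k)).imp ?_
  intro i j hij c hc d hd
  left
  simp only [List.mem_cons, List.not_mem_nil, or_false] at hc hd
  grind

/-- The strictly decreasing circled words with letters of value `≥ k`. -/
def circledWords (n k : ℕ) : Finset (List (CircledLetter n)) :=
  (circledLettersFrom n k).sublists'.toFinset

theorem mem_circledWords {k : ℕ} {l : List (CircledLetter n)} :
    l ∈ circledWords n k ↔
      l.Pairwise (fun c d => circledLT d c) ∧ ∀ c ∈ l, k ≤ (c.1 : ℕ) := by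
  rw [circledWords, List.mem_toFinset, List.mem_sublists',
    List.sublist_iff_pairwise_and_forall_mem (pairwise_circledLettersFrom n k)]
  simp only [mem_circledLettersFrom]

/-- The variable that a circled or uncircled letter in the `k`-th factor contributes. -/
noncomputable def circledVar (n k : ℕ) (c : CircledLetter n) : XYPoly n :=
  if c.2 then ySeq n ((c.1 : ℕ) - k) else xSeq n k

theorem rowProd_eq_sum_circled (n : ℕ) :
    rowProd (heckeGen (XYPoly n) n) n
        (fun k j => xSeq n k + ySeq n (j - k) + xSeq n k * ySeq n (j - k)) =
      ∑ f ∈ Fintype.piFinset fun k : Fin (n + 1) => circledWords n k,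
        (∏ k : Fin (n + 1), ((f k).map (circledVar n k)).prod) •
          MonoidAlgebra.of (XYPoly n) (HeckeMonoid n)
            (eval ((List.ofFn f).flatten.map Prod.fst)) := by
  have hrow : ∀ k : Fin (n + 1), descProd (heckeGen (XYPoly n) n)
        (fun j => xSeq n k + ySeq n (j - k) + xSeq n k * ySeq n (j - k)) k (n - k) =
      ∑ l ∈ circledWords n k, (l.map (circledVar n k)).prod •
        MonoidAlgebra.of (XYPoly n) (HeckeMonoid n) (eval (l.map Prod.fst)) := by
    intro k
    have hfac : ∀ j : Fin n,
        ([(j, false), (j, true)].map fun c => 1 + circledVar n k c • heckeGen (XYPoly n) n c.1).prod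
          = 1 + (xSeq n k + ySeq n (j - k) + xSeq n k * ySeq n (j - k)) •
            heckeGen (XYPoly n) n j := by
      intro j
      rw [← (isHeckeFamily_heckeGen (XYPoly n) n).factor_mul_factor]
      simp [circledVar]
    rw [descProd_eq_prod_lettersFrom _ _ (Nat.lt_succ_iff.mp k.2)]
    simp only [← hfac]
    rw [← List.prod_map_flatMap, ← circledLettersFrom, List.prod_map_one_add_eq_sum
      (fun c : CircledLetter n => circledVar n k c • heckeGen (XYPoly n) n c.1)
      (pairwise_circledLettersFrom n k).nodup]
    exact Finset.sum_congr rfl fun l _ => prod_map_smul_heckeGen _ _ _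
  rw [rowProd_eq_prod_ofFn]
  simp only [hrow]
  rw [List.prod_ofFn_sum]
  refine Finset.sum_congr rfl fun f _ => ?_
  rw [List.ofFn_eq_map, prod_map_smul_of (fun k : Fin (n + 1) => ((f k).map (circledVar n k)).prod)
    (fun k => (f k).map Prod.fst), ← List.ofFn_eq_map, ← List.ofFn_eq_map, List.prod_ofFn,
    List.map_flatten, List.map_ofFn]
  rfl

theorem prod_map_circledVar (k : Fin (n + 1)) (l : List (CircledLetter n))
    (hl : ∀ c ∈ l, (k : ℕ) ≤ (c.1 : ℕ)) :
    (l.map (circledVar n k)).prod =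
      xVar k ^ l.countP (fun c => !c.2) * ∏ i : Fin (n + 1),
        yVar i ^ l.countP fun c => c.2 && decide ((c.1 : ℕ) = (k : ℕ) + (i : ℕ)) := by
  induction l with
  | nil => simp
  | cons c l ih =>
    have hx : xSeq n k = xVar k := varSeq_val _ k
    rw [List.map_cons, List.prod_cons, ih fun d hd => hl d (List.mem_cons_of_mem _ hd)]
    obtain ⟨j, b⟩ := c
    cases b with
    | false => simp [circledVar, hx, pow_succ, mul_assoc, mul_comm]
    | true =>
      have hk : (k : ℕ) ≤ (j : ℕ) := hl _ List.mem_cons_self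
      set i : Fin (n + 1) := ⟨(j : ℕ) - k, by omega⟩ with hi
      have hy : ySeq n ((j : ℕ) - k) = yVar i := varSeq_val _ i
      have hcount : ∀ i' : Fin (n + 1), ((j : ℕ) = (k : ℕ) + (i' : ℕ)) ↔ i' = i := by
        intro i'
        rw [Fin.ext_iff, hi]
        simp only
        omega
      simp only [circledVar, if_true, hy, List.countP_cons, Bool.true_and, hcount,
        decide_eq_true_eq, pow_add, Finset.prod_mul_distrib, Bool.not_true, Bool.false_eq_true,
        if_false, pow_zero, mul_one, pow_ite, pow_one, Finset.prod_ite_eq', Finset.mem_univ]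
      ring

theorem doubleGrothendieck_eq_sum_boundedCircled (w : Perm (Fin (n + 1))) :
    doubleGrothendieck w = ∑ f ∈ (boundedCircled_finite w).toFinset,
      xyMonomial (circledXWeight f) (circledYWeight f) := by
  classical
  rw [doubleGrothendieck_eq_coeff, (isHeckeFamily_heckeGen _ n).ascRowProd_mul_rowProd,
    rowProd_eq_sum_circled, coeff_sum_smul_of]
  have hset : (Fintype.piFinset fun k : Fin (n + 1) => circledWords n k).filter
      (fun f => IsHeckeWord ((List.ofFn f).flatten.map Prod.fst) w) =
      (boundedCircled_finite w).toFinset := by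
    ext f
    simp only [Finset.mem_filter, Fintype.mem_piFinset, mem_circledWords,
      Set.Finite.mem_toFinset, boundedCircled, Set.mem_ofPred_eq, forall_and, and_assoc]
  rw [hset]
  refine Finset.sum_congr rfl fun f hf => ?_
  rw [Set.Finite.mem_toFinset] at hf
  rw [Finset.prod_congr rfl fun k _ => prod_map_circledVar k (f k) (hf.2.1 k),
    Finset.prod_mul_distrib, Finset.prod_comm, xyMonomial]
  simp only [Finset.prod_pow_eq_pow_sum]
  rfl

end Circled

/-! ### The Cauchy formula -/

section Cauchy

open MvPolynomial HeckeMonoid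

variable {n : ℕ}

theorem inX_grothendieck (w : Perm (Fin (n + 1))) :
    inX (grothendieck w) =
      (rowProd (heckeGen (XYPoly n) n) n fun k _ => xSeq n k).coeff (of w) := by
  rw [grothendieck_eq_coeff, inX, ← AlgHom.coe_toRingHom, ← MonoidAlgebra.coeff_mapRingHom,
    mapRingHom_rowProd]
  refine congrArg (fun z => (rowProd (heckeGen (XYPoly n) n) n z).coeff (of w))
    (funext fun k => funext fun _ => ?_)
  unfold xSeq varSeq
  split_ifs <;> simp

theorem inY_grothendieck (w : Perm (Fin (n + 1))) :
    inY (grothendieck w) =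
      (rowProd (heckeGen (XYPoly n) n) n fun k _ => ySeq n k).coeff (of w) := by
  rw [grothendieck_eq_coeff, inY, ← AlgHom.coe_toRingHom, ← MonoidAlgebra.coeff_mapRingHom,
    mapRingHom_rowProd]
  refine congrArg (fun z => (rowProd (heckeGen (XYPoly n) n) n z).coeff (of w))
    (funext fun k => funext fun _ => ?_)
  unfold ySeq varSeq
  split_ifs <;> simp

theorem doubleGrothendieck_eq_sum_heckePairs (w : Perm (Fin (n + 1))) :
    doubleGrothendieck w = ∑ p ∈ (Set.toFinite (heckePairs w)).toFinset,
      inY (grothendieck p.1⁻¹) * inX (grothendieck p.2) := by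
  rw [doubleGrothendieck_eq_coeff, coeff_mul_eq_sum]
  symm
  refine Finset.sum_bij (fun p _ => (of p.1, of p.2)) ?_ ?_ ?_ ?_
  · intro p hp
    rw [Set.Finite.mem_toFinset, mem_heckePairs_iff] at hp
    simpa using hp
  · intro p _ q _ h
    exact h
  · intro p hp
    refine ⟨(p.1.perm, p.2.perm), ?_, rfl⟩
    rw [Set.Finite.mem_toFinset, mem_heckePairs_iff]
    simpa using hp
  · intro p _
    rw [inY_grothendieck, inX_grothendieck, coeff_ascRowProd, perm_of]

end Cauchy

theorem mainTheorem1 (n : ℕ) (ω : Equiv.Perm (Fin (n + 1))) :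
    (doubleGrothendieck ω =
      ∑ f ∈ (boundedCircled_finite ω).toFinset,
        xyMonomial (circledXWeight f) (circledYWeight f)) ∧
    (doubleGrothendieck ω =
      ∑ f ∈ (boundedDouble_finite ω).toFinset,
        xyMonomial (doubleXWeight f) (doubleYWeight f)) ∧
    (doubleGrothendieck ω =
      ∑ p ∈ (Set.toFinite (heckePairs ω)).toFinset,
        inY (grothendieck p.1⁻¹) * inX (grothendieck p.2)) :=
  ⟨doubleGrothendieck_eq_sum_boundedCircled ω, doubleGrothendieck_eq_sum_boundedDouble ω,
    doubleGrothendieck_eq_sum_heckePairs ω⟩
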